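/- Consider linear hyperbolic equations $u_{tx}=T(t,x)\,u_t+X(t,x)\,u_x+U(t,x)\,u$ with smooth real coefficients on an open set of the $(t,x)$-plane, and put $H=-T_t+TX+U$, $K=-X_x+TX+U$, \[ P=\frac KH,\quad Q=\frac{(\ln|H|)_{tx}}{H},\quad I=\frac{P_tP_x}{H},\quad \widetilde Q=\frac{(\ln|K|)_{tx}}{K},\quad J=\frac{H_tP_t-HP_{tt}}{H\,P_t^{2}}, \] \[ J^1_3=H^{-3}(KH_{tx}+HK_{tx}-H_tK_x-H_xK_t), \] \[ J^2_3=H^{-9}(HK_x-KH_x)^2(HKH_{tt}-H^2K_{tt}-3KH_t^2+3HH_tK_t), \] \[ J^3_3=H^{-9}(HK_t-KH_t)^2(HKH_{xx}-H^2K_{xx}-3KH_x^2+3HH_xK_x), \] each regarded as defined where its denominators do not vanish. Two equations with right-hand sides $R$, $\overline R$ are contact equivalent if a smooth local diffeomorphism of the space of $(t,x,u,u_t,u_x)$ preserves the contact form $\vartheta=du-u_t\,dt-u_x\,dx$ up to a factor, and maps $\mathrm{span}(\overline\vartheta,d\overline u_{\overline t}-\overline R\,d\overline x,d\overline t)$ into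 $\mathrm{span}(\vartheta,du_t-R\,dx,dt)$ and $\mathrm{span}(\overline\vartheta,d\overline u_{\overline x}-\overline R\,d\overline t,d\overline x)$ into $\mathrm{span}(\vartheta,du_x-R\,dt,dx)$ by pull-back (so that the two families of characteristics are not interchanged). A differential invariant of a class of equations is a smooth function of a finite jet of $(T,X,U)$, defined on an open set of jets, that is preserved by all contact equivalences between equations of the class. A set $S$ is a basis for the class, with respect to given operators of invariant differentiation, if near every jet of an equation of the class at which it is defined every differential invariant is a function of finitely many elements of $S$ and of their iterated invariant derivatives, all of them defined there. (1) Let $p,q$ be smooth functions of $t$ on an open set with $p,q,p',q'$ nowhere zero, and consider, where $t+x\neq0$, the equation \[ u_{tx}=u_t+\frac{2(p(t)-1)}{q(t)(t+x)}\,u_x+\frac{2\bigl(1-(p(t)-1)(t+x)\bigr)}{q(t)(t+x)^2}\,u . \] For it all the functions above are defined, and $P=p(t)$, $Q=q(t)$, $J^1_3=2p(t)q(t)$, $J^2_3=J^3_3=I=0$, $\widetilde Q=q(t)/p(t)$, while \[ J=-\frac{2}{p'(t)\,(t+x)}-\frac{p''(t)}{p'(t)^2}-\frac{q'(t)}{p'(t)\,q(t)}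 \] has $J_x\neq0$ everywhere. On no nonempty open set is $J$ a function of $P,Q,J^1_3,J^2_3,J^3_3,I,\widetilde Q$ and their iterated invariant derivatives with respect to the operators $P_t^{-1}D_t$, $P_x^{-1}D_x$, $P_tH^{-1}D_x$, $P_xH^{-1}D_t$, $Q_t^{-1}D_t$, $Q_x^{-1}D_x$, $Q_tH^{-1}D_x$, $Q_xH^{-1}D_t$ (as far as they are defined there). Such equations exist. (2) $J$ is a differential invariant of the whole class of linear hyperbolic equations. For any choice of operators of invariant differentiation among the eight just listed, neither $\{P,Q,J^1_3,J^2_3,J^3_3\}$ nor $\{P,Q,I,\widetilde Q\}$ is a basis of differential invariants for the whole class. (3) For a Moutard equation $u_{tx}=U(t,x)\,u$ one has, wherever $U\ne0$, $P=1$, $P_t=P_x=I=0$ and $\widetilde Q=Q$. The invariant $J$ and all derivatives with respect to the operators $\mathcal D_1=P_t^{-1}D_t$, $\mathcal D_2=P_x^{-1}D_x$ are nowhere defined for it. There are a differential invariant of the class of Moutard equations and a Moutard equation with nonempty domain, for which this invariant is everywhere defined, such that on no nonempty open subset of the domain is it a function of those elements of $\{P,Q,I,\widetilde Q,J\}$ and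 of their iterated $\mathcal D_1,\mathcal D_2$-derivatives that are defined there. In particular neither $\{P,Q,I,\widetilde Q\}$ nor $\{P,Q,I,J\}$, with the operators $\mathcal D_1,\mathcal D_2$, is a basis of differential invariants for the class of Moutard equations. -/

import Mathlib

open scoped ContDiff

namespace LinHyp

/-- Partial derivative in the first variable `t`. -/
noncomputable def Dt (f : ℝ × ℝ → ℝ) : ℝ × ℝ → ℝ :=
  fun z => deriv (fun s => f (s, z.2)) z.1

/-- Partial derivative in the second variable `x`. -/
noncomputable def Dx (f : ℝ × ℝ → ℝ) : ℝ × ℝ → ℝ :=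
  fun z => deriv (fun y => f (z.1, y)) z.2

/-- A linear hyperbolic equation `u_tx = T u_t + X u_x + U u` with smooth coefficients on an
open set `dom` of the `(t, x)`-plane. -/
structure Equation where
  dom : Set (ℝ × ℝ)
  isOpen_dom : IsOpen dom
  T : ℝ × ℝ → ℝ
  X : ℝ × ℝ → ℝ
  U : ℝ × ℝ → ℝ
  smooth_T : ContDiffOn ℝ ∞ T dom
  smooth_X : ContDiffOn ℝ ∞ X dom
  smooth_U : ContDiffOn ℝ ∞ U dom

namespace Equation

variable (E : Equation)

/-- The Laplace semi-invariant `H = -T_t + T X + U`. -/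
noncomputable def H : ℝ × ℝ → ℝ := fun z => -Dt E.T z + E.T z * E.X z + E.U z

/-- The Laplace semi-invariant `K = -X_x + T X + U`. -/
noncomputable def K : ℝ × ℝ → ℝ := fun z => -Dx E.X z + E.T z * E.X z + E.U z

/-- `P = K / H`, meaningful where `H ≠ 0`. -/
noncomputable def P : ℝ × ℝ → ℝ := fun z => E.K z / E.H z

/-- `Q = (ln |H|)_tx / H`, meaningful where `H ≠ 0`. -/
noncomputable def Q : ℝ × ℝ → ℝ :=
  fun z => Dx (Dt (fun w => Real.log |E.H w|)) z / E.H z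

/-- The three coefficients as one family. -/
def coeff : Fin 3 → ℝ × ℝ → ℝ := ![E.T, E.X, E.U]

end Equation

/-! ### Jets of equations and (partially defined) differential functions -/

/-- Multi-indices `(i, j)` with `i + j ≤ k`. -/
abbrev JetIndex (k : ℕ) : Type :=
  {ij : Fin (k + 1) × Fin (k + 1) // (ij.1 : ℕ) + (ij.2 : ℕ) ≤ k}

/-- The space of `k`-jets of the coefficient triple `(T, X, U)`: the point `(t, x)` and the
derivatives of the three coefficients of order at most `k`. -/
abbrev Jet (k : ℕ) : Type := ℝ × ℝ × (Fin 3 → JetIndex k → ℝ)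

/-- The `k`-jet of the equation `E` at the point `z`. -/
noncomputable def Equation.jet (E : Equation) (k : ℕ) (z : ℝ × ℝ) : Jet k :=
  (z.1, z.2, fun a ij => Dt^[(ij.1.1 : ℕ)] (Dx^[(ij.1.2 : ℕ)] (E.coeff a)) z)

/-- A rule that assigns to every equation `E` a function `val E` of `(t, x)`, which is
regarded as defined only on the set `dom E`. -/
structure DiffFn where
  dom : Equation → Set (ℝ × ℝ)
  val : Equation → ℝ × ℝ → ℝ

/-- `F` is a differential function of finite order: a smooth function of the `k`-jet of the
coefficients, defined on an open set of jets. -/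
def DiffFn.IsDifferential (F : DiffFn) : Prop :=
  ∃ (k : ℕ) (O : Set (Jet k)) (f : Jet k → ℝ), IsOpen O ∧ ContDiffOn ℝ ∞ f O ∧
    ∀ E : Equation, F.dom E = {z | z ∈ E.dom ∧ E.jet k z ∈ O} ∧
      ∀ z ∈ F.dom E, F.val E z = f (E.jet k z)

/-! ### Contact equivalence -/

/-- The first order jet space with coordinates `(t, x, u, u_t, u_x)`. -/
abbrev J1 : Type := Fin 5 → ℝ

/-- The base point `(t, x)`. -/
def base (w : J1) : ℝ × ℝ := (w 0, w 1)

/-- The differential of the `i`-th coordinate function on `J1`. -/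
noncomputable def dcoord (i : Fin 5) : J1 →L[ℝ] ℝ := ContinuousLinearMap.proj i

/-- The contact form `du - u_t dt - u_x dx`. -/
noncomputable def contactForm (w : J1) : J1 →L[ℝ] ℝ :=
  dcoord 2 - w 3 • dcoord 0 - w 4 • dcoord 1

/-- The right-hand side `T u_t + X u_x + U u`. -/
def Equation.rhs (E : Equation) (w : J1) : ℝ :=
  E.T (base w) * w 3 + E.X (base w) * w 4 + E.U (base w) * w 2

/-- The 1-form `du_t - R dx`, with `R` the right-hand side of the equation. -/
noncomputable def Equation.formT (E : Equation) (w : J1) : J1 →L[ℝ] ℝ :=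
  dcoord 3 - E.rhs w • dcoord 1

/-- The 1-form `du_x - R dt`, with `R` the right-hand side of the equation. -/
noncomputable def Equation.formX (E : Equation) (w : J1) : J1 →L[ℝ] ℝ :=
  dcoord 4 - E.rhs w • dcoord 0

/-- The span of the contact form and of the pair `du_t - R dx`, `dt`. -/
noncomputable def Equation.charT (E : Equation) (w : J1) : Submodule ℝ (J1 →L[ℝ] ℝ) :=
  Submodule.span ℝ {contactForm w, E.formT w, dcoord 0}

/-- The span of the contact form and of the pair `du_x - R dt`, `dx`. -/
noncomputable def Equation.charX (E : Equation) (w : J1) : Submodule ℝ (J1 →L[ℝ] ℝ) :=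
  Submodule.span ℝ {contactForm w, E.formX w, dcoord 1}

/-- `Ψ`, restricted to the open set `W` of `J1`, is a local contact transformation that takes
the equation `E` to the equation `E'`: a smooth local diffeomorphism that preserves the contact
form up to a factor and, modulo the contact form, each of the two pairs of 1-forms
`du_t - R dx, dt` and `du_x - R dt, dx` (so the two families of characteristics are not
interchanged). -/
structure IsContactEquiv (E E' : Equation) (W : Set J1) (Ψ : J1 → J1) : Prop where
  isOpen : IsOpen W
  source : ∀ w ∈ W, base w ∈ E.dom
  target : ∀ w ∈ W, base (Ψ w) ∈ E'.dom
  smooth : ContDiffOn ℝ ∞ Ψ W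
  bijective : ∀ w ∈ W, Function.Bijective (fderiv ℝ Ψ w)
  contact : ∀ w ∈ W, ∃ a : ℝ, (contactForm (Ψ w)).comp (fderiv ℝ Ψ w) = a • contactForm w
  formT : ∀ w ∈ W, (E'.formT (Ψ w)).comp (fderiv ℝ Ψ w) ∈ E.charT w
  formt : ∀ w ∈ W, (dcoord 0).comp (fderiv ℝ Ψ w) ∈ E.charT w
  formX : ∀ w ∈ W, (E'.formX (Ψ w)).comp (fderiv ℝ Ψ w) ∈ E.charX w
  formx : ∀ w ∈ W, (dcoord 1).comp (fderiv ℝ Ψ w) ∈ E.charX w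

/-- `F` is a differential invariant of the equations of the class `C` with respect to the
pseudo-group of contact transformations. -/
def IsDifferentialInvariant (C : Set Equation) (F : DiffFn) : Prop :=
  F.IsDifferential ∧
    ∀ E ∈ C, ∀ E' ∈ C, ∀ (W : Set J1) (Ψ : J1 → J1), IsContactEquiv E E' W Ψ →
      ∀ w ∈ W, base w ∈ F.dom E →
        base (Ψ w) ∈ F.dom E' ∧ F.val E' (base (Ψ w)) = F.val E (base w)

/-! ### Invariant differentiation and bases -/

/-- A differential operator `coefT * D_t + coefX * D_x`, defined where both coefficients are. -/
structure DiffOp where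
  coefT : DiffFn
  coefX : DiffFn

/-- Application of an operator to a differential function. -/
noncomputable def DiffOp.apply (D : DiffOp) (G : DiffFn) : DiffFn where
  dom E := D.coefT.dom E ∩ D.coefX.dom E ∩ interior (G.dom E)
  val E z := D.coefT.val E z * Dt (G.val E) z + D.coefX.val E z * Dx (G.val E) z

/-- The members of `S` and their iterated derivatives along the operators of `𝒟`. -/
inductive Generated (S : Set DiffFn) (𝒟 : Set DiffOp) : DiffFn → Prop
  | basic {G : DiffFn} : G ∈ S → Generated S 𝒟 G
  | derivative {D : DiffOp} {G : DiffFn} :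
      D ∈ 𝒟 → Generated S 𝒟 G → Generated S 𝒟 (D.apply G)

/-- For the single equation `E`, the function `F` is, on the set `V`, a function of finitely many
members of `S` and of their iterated derivatives along `𝒟`, all of them defined on `V`. -/
def IsFunctionOfGenerated (S : Set DiffFn) (𝒟 : Set DiffOp) (F : DiffFn) (E : Equation)
    (V : Set (ℝ × ℝ)) : Prop :=
  ∃ (n : ℕ) (G : Fin n → DiffFn) (Φ : (Fin n → ℝ) → ℝ),
    (∀ i, Generated S 𝒟 (G i) ∧ V ⊆ (G i).dom E) ∧
      ∀ z ∈ V, F.val E z = Φ (fun i => (G i).val E z)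

/-- `S` is a basis of differential invariants for the class `C`, with `𝒟` as operators of
invariant differentiation: near every jet of an equation of `C` at which it is defined, every
differential invariant of `C` is a function of finitely many members of `S` and of their
iterated invariant derivatives, all of them defined there. -/
def IsBasis (C : Set Equation) (S : Set DiffFn) (𝒟 : Set DiffOp) : Prop :=
  ∀ F : DiffFn, IsDifferentialInvariant C F → ∀ E₀ ∈ C, ∀ z₀ ∈ F.dom E₀,
    ∃ (k : ℕ) (O : Set (Jet k)) (n : ℕ) (G : Fin n → DiffFn) (Φ : (Fin n → ℝ) → ℝ),
      IsOpen O ∧ E₀.jet k z₀ ∈ O ∧ (∀ i, Generated S 𝒟 (G i)) ∧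
        ∀ E ∈ C, ∀ z ∈ F.dom E, E.jet k z ∈ O →
          (∀ i, z ∈ (G i).dom E) ∧ F.val E z = Φ (fun i => (G i).val E z)

/-! ### The invariants -/

/-- `P = K / H`. -/
noncomputable def invP : DiffFn where
  dom E := {z | z ∈ E.dom ∧ E.H z ≠ 0}
  val E := E.P

/-- `Q = (ln |H|)_tx / H`. -/
noncomputable def invQ : DiffFn where
  dom E := {z | z ∈ E.dom ∧ E.H z ≠ 0}
  val E := E.Q

/-- `J¹₃ = H⁻³ (K H_tx + H K_tx - H_t K_x - H_x K_t)`. -/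
noncomputable def invJ13 : DiffFn where
  dom E := {z | z ∈ E.dom ∧ E.H z ≠ 0}
  val E z := (E.H z ^ 3)⁻¹ *
    (E.K z * Dx (Dt E.H) z + E.H z * Dx (Dt E.K) z - Dt E.H z * Dx E.K z - Dx E.H z * Dt E.K z)

/-- `J²₃ = H⁻⁹ (H K_x - K H_x)² (H K H_tt - H² K_tt - 3 K H_t² + 3 H H_t K_t)`. -/
noncomputable def invJ23 : DiffFn where
  dom E := {z | z ∈ E.dom ∧ E.H z ≠ 0}
  val E z := (E.H z ^ 9)⁻¹ * (E.H z * Dx E.K z - E.K z * Dx E.H z) ^ 2 *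
    (E.H z * E.K z * Dt (Dt E.H) z - E.H z ^ 2 * Dt (Dt E.K) z
      - 3 * E.K z * Dt E.H z ^ 2 + 3 * E.H z * Dt E.H z * Dt E.K z)

/-- `J³₃ = H⁻⁹ (H K_t - K H_t)² (H K H_xx - H² K_xx - 3 K H_x² + 3 H H_x K_x)`. -/
noncomputable def invJ33 : DiffFn where
  dom E := {z | z ∈ E.dom ∧ E.H z ≠ 0}
  val E z := (E.H z ^ 9)⁻¹ * (E.H z * Dt E.K z - E.K z * Dt E.H z) ^ 2 *
    (E.H z * E.K z * Dx (Dx E.H) z - E.H z ^ 2 * Dx (Dx E.K) z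
      - 3 * E.K z * Dx E.H z ^ 2 + 3 * E.H z * Dx E.H z * Dx E.K z)

/-- `I = P_t P_x / H`. -/
noncomputable def invI : DiffFn where
  dom E := {z | z ∈ E.dom ∧ E.H z ≠ 0}
  val E z := Dt E.P z * Dx E.P z * (E.H z)⁻¹

/-- `Q̃ = (ln |K|)_tx / K`. -/
noncomputable def invQtilde : DiffFn where
  dom E := {z | z ∈ E.dom ∧ E.K z ≠ 0}
  val E z := Dx (Dt (fun w => Real.log |E.K w|)) z * (E.K z)⁻¹

/-- `J = (H_t P_t - H P_tt) H⁻¹ P_t⁻²`. -/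
noncomputable def invJ : DiffFn where
  dom E := {z | z ∈ E.dom ∧ E.H z ≠ 0 ∧ Dt E.P z ≠ 0}
  val E z := (Dt E.H z * Dt E.P z - E.H z * Dt (Dt E.P) z) * (E.H z)⁻¹ * (Dt E.P z ^ 2)⁻¹

/-- The set `P, Q, J¹₃, J²₃, J³₃` of Johnpillai, Mahomed and Wafo Soh. -/
def jmwSet : Set DiffFn := {invP, invQ, invJ13, invJ23, invJ33}

/-- The first set `P, Q, I, Q̃` of Ibragimov. -/
def ibragimovSet₁ : Set DiffFn := {invP, invQ, invI, invQtilde}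

/-- The alternative set `P, Q, I, J` of Ibragimov. -/
def ibragimovSet₂ : Set DiffFn := {invP, invQ, invI, invJ}

/-! ### The operators of invariant differentiation -/

/-- The zero coefficient. -/
def zeroFn : DiffFn where
  dom E := E.dom
  val _ _ := 0

/-- The operator `f⁻¹ D_t`, for `f` built from an expression that is meaningful where `H ≠ 0`. -/
noncomputable def invTimesDt (f : Equation → ℝ × ℝ → ℝ) : DiffOp where
  coefT := { dom := fun E => {z | z ∈ E.dom ∧ E.H z ≠ 0 ∧ f E z ≠ 0}, val := fun E z => (f E z)⁻¹ }
  coefX := zeroFn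

/-- The operator `f⁻¹ D_x`. -/
noncomputable def invTimesDx (f : Equation → ℝ × ℝ → ℝ) : DiffOp where
  coefT := zeroFn
  coefX := { dom := fun E => {z | z ∈ E.dom ∧ E.H z ≠ 0 ∧ f E z ≠ 0}, val := fun E z => (f E z)⁻¹ }

/-- The operator `f H⁻¹ D_t`. -/
noncomputable def overHDt (f : Equation → ℝ × ℝ → ℝ) : DiffOp where
  coefT := { dom := fun E => {z | z ∈ E.dom ∧ E.H z ≠ 0}, val := fun E z => f E z * (E.H z)⁻¹ }
  coefX := zeroFn

/-- The operator `f H⁻¹ D_x`. -/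
noncomputable def overHDx (f : Equation → ℝ × ℝ → ℝ) : DiffOp where
  coefT := zeroFn
  coefX := { dom := fun E => {z | z ∈ E.dom ∧ E.H z ≠ 0}, val := fun E z => f E z * (E.H z)⁻¹ }

/-- Ibragimov's operator `P_t⁻¹ D_t`. -/
noncomputable def ibragimovD₁ : DiffOp := invTimesDt (fun E => Dt E.P)

/-- Ibragimov's operator `P_x⁻¹ D_x`. -/
noncomputable def ibragimovD₂ : DiffOp := invTimesDx (fun E => Dx E.P)

/-- Ibragimov's operators `P_t⁻¹ D_t` and `P_x⁻¹ D_x`. -/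
def ibragimovOps : Set DiffOp := {ibragimovD₁, ibragimovD₂}

/-- All the operators of invariant differentiation in use:
`P_t⁻¹ D_t`, `P_x⁻¹ D_x`, `P_t H⁻¹ D_x`, `P_x H⁻¹ D_t`, and the same with `Q` in place of `P`. -/
def invariantOps : Set DiffOp :=
  {ibragimovD₁, ibragimovD₂, overHDx (fun E => Dt E.P), overHDt (fun E => Dx E.P),
    invTimesDt (fun E => Dt E.Q), invTimesDx (fun E => Dx E.Q),
    overHDx (fun E => Dt E.Q), overHDt (fun E => Dx E.Q)}

/-! ### The equations considered -/

/-- `E` is the equation `u_tx = u_t + 2 (p - 1) / (q (t + x)) u_x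
+ 2 (1 - (p - 1) (t + x)) / (q (t + x)²) u`, with `p`, `q` smooth functions of `t` on an open set
`A` and `p`, `q`, `p'`, `q'` nowhere zero there, on an open set where `t + x ≠ 0`. -/
structure IsCounterexample (A : Set ℝ) (p q : ℝ → ℝ) (E : Equation) : Prop where
  isOpen : IsOpen A
  smooth_p : ContDiffOn ℝ ∞ p A
  smooth_q : ContDiffOn ℝ ∞ q A
  p_ne : ∀ t ∈ A, p t ≠ 0
  q_ne : ∀ t ∈ A, q t ≠ 0
  deriv_p_ne : ∀ t ∈ A, deriv p t ≠ 0
  deriv_q_ne : ∀ t ∈ A, deriv q t ≠ 0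
  dom : ∀ z ∈ E.dom, z.1 ∈ A ∧ z.1 + z.2 ≠ 0
  T_eq : ∀ z ∈ E.dom, E.T z = 1
  X_eq : ∀ z ∈ E.dom, E.X z = 2 * (p z.1 - 1) / (q z.1 * (z.1 + z.2))
  U_eq : ∀ z ∈ E.dom,
    E.U z = 2 * (1 - (p z.1 - 1) * (z.1 + z.2)) / (q z.1 * (z.1 + z.2) ^ 2)

/-- The subclass of Moutard equations `u_tx = U u`. -/
def moutardClass : Set Equation := {E | ∀ z ∈ E.dom, E.T z = 0 ∧ E.X z = 0}

end LinHyp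

/-!
The two characteristic systems of the equation are Pfaffian systems of rank three on the first
order jet space. A first integral of `{ϑ, du_t - R dx, dt}` is, as the brackets of the dual vector
fields show, a function of `t` alone wherever `K ≠ 0`, and a first integral of
`{ϑ, du_x - R dt, dx}` is a function of `x` alone wherever `H ≠ 0`
(`firstIntegral_charT`, `firstIntegral_charX`). Hence, where `H ≠ 0` and `K` vanishes on no open
set, a contact equivalence that keeps the two systems apart acts on the base as
`(t, x) ↦ (φ t, ψ x)`. The contact condition and the form of the equation then force it to be
affine in `u`, and elimination of the factor of `u` gives `H = φ' ψ' H'(φ, ψ)` and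
`K = φ' ψ' K'(φ, ψ)` (`IsContactEquiv.exists_isBaseChange`). At a point where `H P_t ≠ 0` this
applies, since `K = 0` on an open set would give `P_t = 0` there.

If `h` is multiplied by the Jacobian of such changes and `f` is unchanged, then
`(h_t f_t - h f_tt) / (h f_t²)` is unchanged (`jExpr_comp`). With `f = P`, `h = H` this is `J`.
For Moutard equations `H = K = U`, so `P = 1` and `J` is nowhere defined, but the same expression
with `f = (ln |U|)_tx / U` and `h = U` is an invariant of that class (`invMoutard`).

If `h = 2 / (q(t) (t + x)²)` then `(ln |h|)_tx / h = q(t)`. For the explicit equation `H` has this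
form and `K = p(t) H`, so `P`, `Q`, `Q̃` and the other listed invariants, except `J`, depend on `t`
only. Invariant differentiation preserves this property: `D_x` annihilates such functions, and the
coefficients of `D_t` in the given operators depend on `t` only
(`Generated.independentOfX`). On the other hand `J` has nonzero `x`-derivative, so it is no
function of the generated invariants. The Moutard equation with `U = 2 / (t (t + x)²)` and the
invariant `invMoutard` behave in the same way.
-/

namespace LinHyp

open Filter Topology Set

/-! ### Partial derivatives in the plane -/

section Plane

variable {f g : ℝ × ℝ → ℝ} {s : Set (ℝ × ℝ)} {z : ℝ × ℝ}

lemma hasDerivAt_fst_of_hasFDerivAt {f' : ℝ × ℝ →L[ℝ] ℝ} (hf : HasFDerivAt f f' z) :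
    HasDerivAt (fun r => f (r, z.2)) (f' (1, 0)) z.1 :=
  HasFDerivAt.comp_hasDerivAt (f := fun r : ℝ => (r, z.2)) z.1 hf
    ((hasDerivAt_id z.1).prodMk (hasDerivAt_const z.1 z.2))

lemma hasDerivAt_snd_of_hasFDerivAt {f' : ℝ × ℝ →L[ℝ] ℝ} (hf : HasFDerivAt f f' z) :
    HasDerivAt (fun y => f (z.1, y)) (f' (0, 1)) z.2 :=
  HasFDerivAt.comp_hasDerivAt (f := fun y : ℝ => (z.1, y)) z.2 hf
    ((hasDerivAt_const z.2 z.1).prodMk (hasDerivAt_id z.2))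

lemma Dt_eq_fderiv (hf : DifferentiableAt ℝ f z) : Dt f z = fderiv ℝ f z (1, 0) :=
  (hasDerivAt_fst_of_hasFDerivAt hf.hasFDerivAt).deriv

lemma Dx_eq_fderiv (hf : DifferentiableAt ℝ f z) : Dx f z = fderiv ℝ f z (0, 1) :=
  (hasDerivAt_snd_of_hasFDerivAt hf.hasFDerivAt).deriv

lemma hasDerivAt_Dt (hf : DifferentiableAt ℝ f z) :
    HasDerivAt (fun r => f (r, z.2)) (Dt f z) z.1 := by
  rw [Dt_eq_fderiv hf]
  exact hasDerivAt_fst_of_hasFDerivAt hf.hasFDerivAt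

lemma hasDerivAt_Dx (hf : DifferentiableAt ℝ f z) :
    HasDerivAt (fun y => f (z.1, y)) (Dx f z) z.2 := by
  rw [Dx_eq_fderiv hf]
  exact hasDerivAt_snd_of_hasFDerivAt hf.hasFDerivAt

lemma differentiableAt_of_smooth (hs : IsOpen s) (hf : ContDiffOn ℝ ∞ f s) (hz : z ∈ s) :
    DifferentiableAt ℝ f z :=
  (hf.contDiffAt (hs.mem_nhds hz)).differentiableAt (by simp)

lemma smooth_Dt (hs : IsOpen s) (hf : ContDiffOn ℝ ∞ f s) : ContDiffOn ℝ ∞ (Dt f) s :=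
  ((hf.fderiv_of_isOpen (m := ∞) hs (by simp)).clm_apply contDiffOn_const).congr
    fun _ hz => Dt_eq_fderiv (differentiableAt_of_smooth hs hf hz)

lemma smooth_Dx (hs : IsOpen s) (hf : ContDiffOn ℝ ∞ f s) : ContDiffOn ℝ ∞ (Dx f) s :=
  ((hf.fderiv_of_isOpen (m := ∞) hs (by simp)).clm_apply contDiffOn_const).congr
    fun _ hz => Dx_eq_fderiv (differentiableAt_of_smooth hs hf hz)

lemma eventually_fst_mem (hs : IsOpen s) (hz : z ∈ s) : ∀ᶠ r in 𝓝 z.1, (r, z.2) ∈ s :=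
  (Continuous.prodMk_left z.2).continuousAt.preimage_mem_nhds (hs.mem_nhds hz)

lemma eventually_snd_mem (hs : IsOpen s) (hz : z ∈ s) : ∀ᶠ y in 𝓝 z.2, (z.1, y) ∈ s :=
  (Continuous.prodMk_right z.1).continuousAt.preimage_mem_nhds (hs.mem_nhds hz)

lemma Dt_congr (hs : IsOpen s) (h : EqOn f g s) : EqOn (Dt f) (Dt g) s := fun _ hz =>
  EventuallyEq.deriv_eq ((eventually_fst_mem hs hz).mono fun _ hr => h hr)

lemma Dx_congr (hs : IsOpen s) (h : EqOn f g s) : EqOn (Dx f) (Dx g) s := fun _ hz =>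
  EventuallyEq.deriv_eq ((eventually_snd_mem hs hz).mono fun _ hr => h hr)

/-- To compute `D_t` on an open set, replace the function there by any expression. -/
lemma Dt_eq_of_hasDerivAt (hs : IsOpen s) (h : EqOn f g s) (hz : z ∈ s) {d : ℝ}
    (hd : HasDerivAt (fun r => g (r, z.2)) d z.1) : Dt f z = d :=
  (Dt_congr hs h hz).trans hd.deriv

/-- To compute `D_x` on an open set, replace the function there by any expression. -/
lemma Dx_eq_of_hasDerivAt (hs : IsOpen s) (h : EqOn f g s) (hz : z ∈ s) {d : ℝ}
    (hd : HasDerivAt (fun y => g (z.1, y)) d z.2) : Dx f z = d :=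
  (Dx_congr hs h hz).trans hd.deriv

lemma smooth_iterate_Dx (hs : IsOpen s) (hf : ContDiffOn ℝ ∞ f s) (n : ℕ) :
    ContDiffOn ℝ ∞ (Dx^[n] f) s := by
  induction n with
  | zero => exact hf
  | succ n ih => rw [Function.iterate_succ_apply']; exact smooth_Dx hs ih

lemma smooth_iterate_Dt (hs : IsOpen s) (hf : ContDiffOn ℝ ∞ f s) (n : ℕ) :
    ContDiffOn ℝ ∞ (Dt^[n] f) s := by
  induction n with
  | zero => exact hf
  | succ n ih => rw [Function.iterate_succ_apply']; exact smooth_Dt hs ih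

end Plane

namespace Equation

variable (E : Equation)

lemma smooth_coeff (a : Fin 3) : ContDiffOn ℝ ∞ (E.coeff a) E.dom := by
  fin_cases a
  exacts [E.smooth_T, E.smooth_X, E.smooth_U]

lemma smooth_H : ContDiffOn ℝ ∞ E.H E.dom :=
  ((smooth_Dt E.isOpen_dom E.smooth_T).neg.add (E.smooth_T.mul E.smooth_X)).add E.smooth_U

lemma smooth_K : ContDiffOn ℝ ∞ E.K E.dom :=
  ((smooth_Dx E.isOpen_dom E.smooth_X).neg.add (E.smooth_T.mul E.smooth_X)).add E.smooth_U

lemma isOpen_H_ne : IsOpen {z | z ∈ E.dom ∧ E.H z ≠ 0} :=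
  E.smooth_H.continuousOn.isOpen_inter_preimage E.isOpen_dom isOpen_ne

lemma smooth_P : ContDiffOn ℝ ∞ E.P {z | z ∈ E.dom ∧ E.H z ≠ 0} :=
  (E.smooth_K.mono fun _ h => h.1).div (E.smooth_H.mono fun _ h => h.1) fun _ h => h.2

lemma continuousOn_jet (k : ℕ) : ContinuousOn (E.jet k) E.dom := by
  refine continuousOn_fst.prodMk (continuousOn_snd.prodMk ?_)
  refine continuousOn_pi.2 fun a => continuousOn_pi.2 fun ij => ?_
  exact (smooth_iterate_Dt E.isOpen_dom
    (smooth_iterate_Dx E.isOpen_dom (E.smooth_coeff a) _) _).continuousOn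

end Equation

/-! ### Bases and functional dependence -/

/-- A basis for a class expresses every invariant, on each single equation, as a function of the
generated invariants near any point at which it is defined. -/
lemma IsBasis.exists_isFunctionOfGenerated {C : Set Equation} {S : Set DiffFn} {𝒟 : Set DiffOp}
    (hB : IsBasis C S 𝒟) {F : DiffFn} (hF : IsDifferentialInvariant C F) {E : Equation}
    (hE : E ∈ C) (hdom : E.dom ⊆ F.dom E) (hne : E.dom.Nonempty) :
    ∃ V : Set (ℝ × ℝ), IsOpen V ∧ V.Nonempty ∧ V ⊆ E.dom ∧
      IsFunctionOfGenerated S 𝒟 F E V := by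
  obtain ⟨z₀, hz₀⟩ := hne
  obtain ⟨k, O, n, G, Φ, hO, hz₀O, hG, h⟩ := hB F hF E hE z₀ (hdom hz₀)
  refine ⟨E.dom ∩ E.jet k ⁻¹' O, (E.continuousOn_jet k).isOpen_inter_preimage E.isOpen_dom hO,
    ⟨z₀, hz₀, hz₀O⟩, inter_subset_left, n, G, Φ, fun i => ⟨hG i, fun z hz => ?_⟩, fun z hz => ?_⟩
  · exact (h E hE z (hdom hz.1) hz.2).1 i
  · exact (h E hE z (hdom hz.1) hz.2).2

lemma Generated.mono {S S' : Set DiffFn} {𝒟 𝒟' : Set DiffOp} (hS : S ⊆ S') (h𝒟 : 𝒟 ⊆ 𝒟')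
    {G : DiffFn} (h : Generated S 𝒟 G) : Generated S' 𝒟' G := by
  induction h with
  | basic h => exact .basic (hS h)
  | derivative hD _ ih => exact .derivative (h𝒟 hD) ih

lemma IsFunctionOfGenerated.mono {S S' : Set DiffFn} {𝒟 𝒟' : Set DiffOp} (hS : S ⊆ S')
    (h𝒟 : 𝒟 ⊆ 𝒟') {F : DiffFn} {E : Equation} {V : Set (ℝ × ℝ)}
    (h : IsFunctionOfGenerated S 𝒟 F E V) : IsFunctionOfGenerated S' 𝒟' F E V := by
  obtain ⟨n, G, Φ, hG, hΦ⟩ := h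
  exact ⟨n, G, Φ, fun i => ⟨(hG i).1.mono hS h𝒟, (hG i).2⟩, hΦ⟩

/-! ### Contact equivalences as differential algebra -/

section Algebra

variable {A : Type*} [CommRing A] [Algebra ℝ A]

/-- The fields `Y = ∂ₓ + q ∂ᵤ + R ∂ₚ` (with `R = T p + X q + U u`) and `∂_q` span one of the two
characteristic distributions. A function `f` annihilated by both is annihilated by their bracket
`∂ᵤ + X ∂ₚ`, and by the bracket of `Y` with the latter, which is `-K ∂ₚ` modulo `∂ᵤ + X ∂ₚ`. -/
theorem firstIntegral_algebra (dx du dp dq : Derivation ℝ A A)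
    (hcx : ∀ a, dq (dx a) = dx (dq a)) (hcu : ∀ a, dq (du a) = du (dq a))
    (hcp : ∀ a, dq (dp a) = dp (dq a)) (hcxu : ∀ a, du (dx a) = dx (du a))
    (hcxp : ∀ a, dp (dx a) = dx (dp a)) (hcup : ∀ a, dp (du a) = du (dp a))
    {u p q T X U f : A}
    (hqu : dq u = 0) (hqp : dq p = 0) (hqq : dq q = 1)
    (huu : du u = 1) (hup : du p = 0) (huq : du q = 0)
    (hpu : dp u = 0) (hpp : dp p = 1) (hpq : dp q = 0)
    (hT : du T = 0 ∧ dp T = 0 ∧ dq T = 0) (hX : du X = 0 ∧ dp X = 0 ∧ dq X = 0)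
    (hU : du U = 0 ∧ dp U = 0 ∧ dq U = 0)
    (hf : dq f = 0) (hY : dx f + q * du f + (T * p + X * q + U * u) * dp f = 0) :
    du f + X * dp f = 0 ∧ (-dx X + T * X + U) * dp f = 0 := by
  obtain ⟨huT, hpT, hqT⟩ := hT
  obtain ⟨huX, hpX, hqX⟩ := hX
  obtain ⟨huU, hpU, hqU⟩ := hU
  have h1 : du f + X * dp f = 0 := by
    have := congrArg dq hY
    simp only [map_add, Derivation.leibniz, smul_eq_mul, hcx, hcu, hcp, hf, hqu, hqp, hqq, hqT,
      hqX, hqU, map_zero] at this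
    linear_combination this
  refine ⟨h1, ?_⟩
  have hx := congrArg dx h1
  have hu := congrArg du h1
  have hp := congrArg dp h1
  have hYu := congrArg du hY
  have hYp := congrArg dp hY
  simp only [map_add, Derivation.leibniz, smul_eq_mul, hcxu, hcxp, hcup, huu, hup, huq, hpu, hpp,
    hpq, huT, huX, huU, hpT, hpX, hpU, map_zero] at hx hu hp hYu hYp
  linear_combination hYu + X * hYp - hx - q * hu - (T * p + X * q + U * u) * hp

/-- Let `(τ(t), ξ(x), υ, π, κ)` be the components of a contact equivalence, and let `σ = ∂ᵤυ`.
The contact condition (`h1`, `h2`) determines `π` and `κ`, and `h3` says that the equation is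
taken to the equation with coefficients `T'`, `X'`, `U'` (composed with the map). Differentiation
of `h3` along `q`, `p` and `u` gives the transformation rules
`σ_t + X σ = τ_t X' σ`, `σ_x + T σ = ξ_x T' σ` and
`σ_tx + U σ = ξ_x T' σ_t + τ_t X' σ_x + τ_t ξ_x U' σ`, from which `σ` is eliminated. The factor
`σ` remains because the ring has zero divisors. `T't` and `X'x` stand for the partial derivatives
of `T'` and `X'` composed with the map. -/
theorem laplace_algebra (dt dx du dp dq : Derivation ℝ A A)
    (htx : ∀ a, dt (dx a) = dx (dt a)) (htu : ∀ a, du (dt a) = dt (du a))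
    (hxu : ∀ a, du (dx a) = dx (du a)) (htp : ∀ a, dp (dt a) = dt (dp a))
    (hxp : ∀ a, dp (dx a) = dx (dp a)) (hup : ∀ a, dp (du a) = du (dp a))
    (htq : ∀ a, dq (dt a) = dt (dq a)) (hxq : ∀ a, dq (dx a) = dx (dq a))
    (huq : ∀ a, dq (du a) = du (dq a))
    {u p q T X U τ ξ υ π κ T' X' U' T't X'x : A}
    (duu : du u = 1) (dup : du p = 0) (duq : du q = 0)
    (dpu : dp u = 0) (dpp : dp p = 1) (dpq : dp q = 0)
    (dqu : dq u = 0) (dqp : dq p = 0) (dqq : dq q = 1)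
    (hT : du T = 0 ∧ dp T = 0 ∧ dq T = 0) (hX : du X = 0 ∧ dp X = 0 ∧ dq X = 0)
    (hU : du U = 0 ∧ dp U = 0 ∧ dq U = 0)
    (hT' : du T' = 0 ∧ dp T' = 0 ∧ dq T' = 0) (hX' : du X' = 0 ∧ dp X' = 0 ∧ dq X' = 0)
    (hU' : du U' = 0 ∧ dp U' = 0 ∧ dq U' = 0)
    (hT't : dt T' = T't * dt τ) (hX'x : dx X' = X'x * dx ξ)
    (hτ : dx τ = 0 ∧ du τ = 0 ∧ dp τ = 0 ∧ dq τ = 0)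
    (hξ : dt ξ = 0 ∧ du ξ = 0 ∧ dp ξ = 0 ∧ dq ξ = 0)
    (hυp : dp υ = 0) (hυq : dq υ = 0)
    (h1 : dt υ = π * dt τ - du υ * p) (h2 : dx υ = κ * dx ξ - du υ * q)
    (hπq : dq π = 0) (hκp : dp κ = 0)
    (h3 : dx π + q * du π + (T * p + X * q + U * u) * dp π = (T' * π + X' * κ + U' * υ) * dx ξ) :
    du υ * (-dt T + T * X + U) = du υ * (dt τ * dx ξ * (-T't + T' * X' + U')) ∧
    du υ * (-dx X + T * X + U) = du υ * (dt τ * dx ξ * (-X'x + T' * X' + U')) := by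
  obtain ⟨duT, dpT, dqT⟩ := hT
  obtain ⟨duX, dpX, dqX⟩ := hX
  obtain ⟨duU, dpU, dqU⟩ := hU
  obtain ⟨duT', dpT', dqT'⟩ := hT'
  obtain ⟨duX', dpX', dqX'⟩ := hX'
  obtain ⟨duU', dpU', dqU'⟩ := hU'
  obtain ⟨dxτ, duτ, dpτ, dqτ⟩ := hτ
  obtain ⟨dtξ, duξ, dpξ, dqξ⟩ := hξ
  obtain ⟨σ, hσ⟩ : ∃ σ, du υ = σ := ⟨_, rfl⟩
  rw [hσ] at h1 h2 ⊢
  have dpσ : dp σ = 0 := by rw [← hσ, hup, hυp, map_zero]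
  have dqσ : dq σ = 0 := by rw [← hσ, huq, hυq, map_zero]
  have hπp : dp π * dt τ = σ := by
    have := congrArg dp h1
    simp only [map_sub, Derivation.leibniz, smul_eq_mul, htp, hυp, dpτ, dpσ, dpp, map_zero] at this
    linear_combination -this
  have hκq : dq κ * dx ξ = σ := by
    have := congrArg dq h2
    simp only [map_sub, Derivation.leibniz, smul_eq_mul, hxq, hυq, dqξ, dqσ, dqq, map_zero] at this
    linear_combination -this
  have hπu : du π * dt τ = dt σ + du σ * p := by
    have := congrArg du h1
    simp only [map_sub, Derivation.leibniz, smul_eq_mul, htu, hσ, duτ, dup, map_zero] at this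
    linear_combination -this
  have hκu : du κ * dx ξ = dx σ + du σ * q := by
    have := congrArg du h2
    simp only [map_sub, Derivation.leibniz, smul_eq_mul, hxu, hσ, duξ, duq, map_zero] at this
    linear_combination -this
  -- the `q`-derivative of the transformed equation
  have h4' : dt σ + du σ * p + X * σ = dt τ * X' * σ := by
    have := congrArg dq h3
    simp only [map_add, Derivation.leibniz, smul_eq_mul, hxq, huq, hπq, hυq, dqT,
      dqX, dqU, dqT', dqX', dqU', dqξ, dqu, dqp, dqq, map_zero] at this
    have hqp : dq (dp π) * dt τ = 0 := by
      have := congrArg dq hπp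
      simp only [Derivation.leibniz, smul_eq_mul, htq, dqτ, dqσ, map_zero] at this
      linear_combination this
    linear_combination dt τ * this - hπu - X * hπp - (T * p + X * q + U * u) * hqp
      + dt τ * X' * hκq
  have hσu : du σ = 0 := by
    have := congrArg dp h4'
    simp only [map_add, Derivation.leibniz, smul_eq_mul, htp, hup, dpσ, dpp, dpX, dpX', dpτ,
      map_zero] at this
    linear_combination this
  have h4 : dt σ + X * σ = dt τ * X' * σ := by linear_combination h4' - p * hσu
  -- the `p`-derivative of the transformed equation
  have h5 : dx σ + T * σ = dx ξ * T' * σ := by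
    have := congrArg dp h3
    simp only [map_add, Derivation.leibniz, smul_eq_mul, hxp, hup, hκp, hυp, dpT,
      dpX, dpU, dpT', dpX', dpU', dpξ, dpu, dpp, dpq, map_zero] at this
    have e1 := congrArg dx hπp
    have e2 := congrArg du hπp
    have e3 := congrArg dp hπp
    simp only [Derivation.leibniz, smul_eq_mul, ← htx, htu, htp, dxτ, duτ, dpτ, dpσ, hσu,
      map_zero] at e1 e2 e3
    linear_combination dt τ * this - e1 - q * e2 - T * hπp - (T * p + X * q + U * u) * e3
      + dx ξ * T' * hπp
  -- the `u`-derivative of the transformed equation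
  have h6 : dx (dt σ) + U * σ =
      dx ξ * T' * dt σ + dt τ * X' * dx σ + dt τ * dx ξ * U' * σ := by
    have := congrArg du h3
    simp only [map_add, Derivation.leibniz, smul_eq_mul, hxu, hσ, duT,
      duX, duU, duT', duX', duU', duξ, duu, dup, duq, map_zero] at this
    have hπu' : du π * dt τ = dt σ := by linear_combination hπu + p * hσu
    have hκu' : du κ * dx ξ = dx σ := by linear_combination hκu + q * hσu
    have e1 := congrArg dx hπu'
    have e2 := congrArg du hπu'
    have e3 := congrArg dp hπu'
    simp only [Derivation.leibniz, smul_eq_mul, ← htx, htu, htp, dxτ, duτ, dpτ, dpσ, hσu, hup,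
      map_zero] at e1 e2 e3
    rw [htx] at e1
    linear_combination dt τ * this - e1 - q * e2 - U * hπp - (T * p + X * q + U * u) * e3
      + dx ξ * T' * hπu' + dt τ * X' * hκu'
  have h5t := congrArg dt h5
  have h4x := congrArg dx h4
  simp only [map_add, Derivation.leibniz, smul_eq_mul, htx, dtξ, hT't, map_zero]
    at h5t
  simp only [map_add, Derivation.leibniz, smul_eq_mul, ← htx, dxτ, hX'x, map_zero]
    at h4x
  rw [htx] at h4x
  constructor
  · linear_combination h6 - h5t + T * h4 + dt τ * X' * h5
  · linear_combination h6 - h4x + X * h5 + dx ξ * T' * h4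

end Algebra

/-! ### The ring of smooth functions on an open subset of the first order jet space -/

/-- The derivative of `f` in the direction of the `i`-th coordinate of `J1`, where the
coordinates `0, …, 4` are `t, x, u, u_t, u_x`. -/
noncomputable def pd (i : Fin 5) (f : J1 → ℝ) : J1 → ℝ := fun w => fderiv ℝ f w (Pi.single i 1)

lemma pd_coord (i j : Fin 5) : pd i (fun w => w j) = fun _ => if i = j then 1 else 0 := by
  funext w
  have : HasFDerivAt (fun w : J1 => w j) (dcoord j) w := (dcoord j).hasFDerivAt
  simp only [pd]
  rw [this.fderiv]
  simp [dcoord, Pi.single_apply, eq_comm]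

section Smooth

variable {N : TopologicalSpace.Opens J1} {f g : J1 → ℝ} {i j : Fin 5}

lemma smooth_pd (hf : ContDiffOn ℝ ∞ f N) (i : Fin 5) : ContDiffOn ℝ ∞ (pd i f) N :=
  (hf.fderiv_of_isOpen (m := ∞) N.isOpen (by simp)).clm_apply contDiffOn_const

lemma pd_congr (h : EqOn f g N) (i : Fin 5) : EqOn (pd i f) (pd i g) N := fun w hw => by
  have : f =ᶠ[𝓝 w] g := (N.isOpen.mem_nhds hw : (N : Set J1) ∈ 𝓝 w) |> fun hN =>
    Filter.eventually_of_mem hN fun _ h' => h h'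
  simp only [pd, this.fderiv_eq]

lemma differentiableAt_of_smooth_J1 (hf : ContDiffOn ℝ ∞ f N) {w : J1} (hw : w ∈ N) :
    DifferentiableAt ℝ f w :=
  (hf.contDiffAt (N.isOpen.mem_nhds hw)).differentiableAt (by simp)

lemma pd_comm (hf : ContDiffOn ℝ ∞ f N) (i j : Fin 5) {w : J1} (hw : w ∈ N) :
    pd i (pd j f) w = pd j (pd i f) w := by
  have hs : IsSymmSndFDerivAt ℝ f w :=
    (hf.contDiffAt (N.isOpen.mem_nhds hw)).isSymmSndFDerivAt (by
      simp only [minSmoothness_of_isRCLikeNormedField]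
      exact ENat.LEInfty.out)
  have hd : DifferentiableAt ℝ (fderiv ℝ f) w :=
    ((hf.fderiv_of_isOpen (m := ∞) N.isOpen (by simp)).contDiffAt
      (N.isOpen.mem_nhds hw)).differentiableAt (by simp)
  have key : ∀ a b : Fin 5, pd a (pd b f) w =
      fderiv ℝ (fderiv ℝ f) w (Pi.single a 1) (Pi.single b 1) := fun a b => by
    have := fderiv_clm_apply hd (differentiableAt_const (Pi.single b (1 : ℝ) : J1))
    change fderiv ℝ (fun y => fderiv ℝ f y (Pi.single b 1)) w (Pi.single a 1) = _
    rw [this]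
    simp
  rw [key, key]
  exact hs _ _

/-- The algebra of smooth real functions on the open set `N`; an element is a function on the
subtype `N` that is the restriction of a function on `J1` smooth on `N`. -/
def smoothSubalgebra (N : TopologicalSpace.Opens J1) : Subalgebra ℝ (N → ℝ) where
  carrier := {g | ∃ f : J1 → ℝ, ContDiffOn ℝ ∞ f N ∧ ∀ w : N, g w = f w}
  mul_mem' := by
    rintro _ _ ⟨f, hf, hf'⟩ ⟨g, hg, hg'⟩
    exact ⟨fun w => f w * g w, hf.mul hg, fun w => by simp [hf', hg']⟩
  add_mem' := by
    rintro _ _ ⟨f, hf, hf'⟩ ⟨g, hg, hg'⟩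
    exact ⟨fun w => f w + g w, hf.add hg, fun w => by simp [hf', hg']⟩
  algebraMap_mem' r := ⟨fun _ => r, contDiffOn_const, fun _ => rfl⟩

/-- The ring of smooth real functions on the open set `N`. -/
def SmoothRing (N : TopologicalSpace.Opens J1) : Type := smoothSubalgebra N

noncomputable instance : CommRing (SmoothRing N) := inferInstanceAs (CommRing (smoothSubalgebra N))

noncomputable instance : Algebra ℝ (SmoothRing N) :=
  inferInstanceAs (Algebra ℝ (smoothSubalgebra N))

namespace SmoothRing

/-- A function on `J1` that is smooth on `N`, as an element of the ring. -/
def of (f : J1 → ℝ) (hf : ContDiffOn ℝ ∞ f N) : SmoothRing N :=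
  ⟨fun w => f w, f, hf, fun _ => rfl⟩

/-- A function on `J1` whose restriction to `N` is the given element of the ring. -/
noncomputable def rep (a : SmoothRing N) : J1 → ℝ := a.2.choose

lemma smooth_rep (a : SmoothRing N) : ContDiffOn ℝ ∞ (rep a) N := a.2.choose_spec.1

lemma rep_apply (a : SmoothRing N) {w : J1} (hw : w ∈ N) : rep a w = a.1 ⟨w, hw⟩ :=
  (a.2.choose_spec.2 ⟨w, hw⟩).symm

lemma eq_iff {a b : SmoothRing N} : a = b ↔ ∀ w (hw : w ∈ N), a.1 ⟨w, hw⟩ = b.1 ⟨w, hw⟩ :=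
  ⟨fun h _ _ => by rw [h], fun h => Subtype.ext (funext fun w => h w.1 w.2)⟩

/-- The partial derivative as a derivation of the ring of smooth functions. -/
noncomputable def D (i : Fin 5) : Derivation ℝ (SmoothRing N) (SmoothRing N) :=
  Derivation.mk'
    { toFun := fun a => of (pd i (rep a)) (smooth_pd (smooth_rep a) i)
      map_add' := fun a b => eq_iff.2 fun w hw => by
        have : EqOn (rep (a + b)) (rep a + rep b) N := fun v hv => by
          simp only [Pi.add_apply, rep_apply _ hv]; rfl
        change pd i (rep (a + b)) w = pd i (rep a) w + pd i (rep b) w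
        rw [pd_congr this i hw]
        simp only [pd]
        rw [fderiv_add (differentiableAt_of_smooth_J1 (smooth_rep a) hw)
          (differentiableAt_of_smooth_J1 (smooth_rep b) hw)]
        rfl
      map_smul' := fun r a => eq_iff.2 fun w hw => by
        have : EqOn (rep (r • a)) (r • rep a) N := fun v hv => by
          simp only [Pi.smul_apply, rep_apply _ hv]; rfl
        change pd i (rep (r • a)) w = r * pd i (rep a) w
        rw [pd_congr this i hw]
        simp only [pd]
        rw [fderiv_const_smul (differentiableAt_of_smooth_J1 (smooth_rep a) hw)]
        rfl }
    fun a b => eq_iff.2 fun w hw => by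
      have : EqOn (rep (a * b)) (rep a * rep b) N := fun v hv => by
        simp only [Pi.mul_apply, rep_apply _ hv]; rfl
      change pd i (rep (a * b)) w = a.1 ⟨w, hw⟩ * pd i (rep b) w + b.1 ⟨w, hw⟩ * pd i (rep a) w
      rw [pd_congr this i hw]
      simp only [pd]
      rw [fderiv_mul (differentiableAt_of_smooth_J1 (smooth_rep a) hw)
        (differentiableAt_of_smooth_J1 (smooth_rep b) hw), ← rep_apply a hw, ← rep_apply b hw]
      rfl

/-- Evaluation of the elements of the ring at a point of `N`. -/
noncomputable def eval (w : N) : SmoothRing N →+* ℝ :=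
  (Pi.evalRingHom (fun _ : N => ℝ) w).comp (smoothSubalgebra N).subtype

lemma eval_of (hf : ContDiffOn ℝ ∞ f N) (w : N) : eval w (of f hf) = f w := rfl

lemma eval_D_of (hf : ContDiffOn ℝ ∞ f N) (i : Fin 5) (w : N) :
    eval w (D i (of f hf)) = pd i f w :=
  pd_congr (fun _ hv => rep_apply (of f hf) hv) i w.2

lemma ext_eval {a b : SmoothRing N} (h : ∀ w, eval w a = eval w b) : a = b :=
  Subtype.ext (funext h)

lemma D_of (hf : ContDiffOn ℝ ∞ f N) (i : Fin 5) : D i (of f hf) = of (pd i f) (smooth_pd hf i) :=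
  ext_eval (eval_D_of hf i)

lemma exists_eq_of (a : SmoothRing N) : ∃ (f : J1 → ℝ) (hf : ContDiffOn ℝ ∞ f N), a = of f hf :=
  ⟨rep a, smooth_rep a, eq_iff.2 fun _ hw => (rep_apply a hw).symm⟩

lemma D_comm (i j : Fin 5) (a : SmoothRing N) : D i (D j a) = D j (D i a) := by
  obtain ⟨f, hf, rfl⟩ := exists_eq_of a
  simp only [D_of]
  exact ext_eval fun w => pd_comm hf i j w.2

/-- The coordinate functions as elements of the ring. -/
def coord (N : TopologicalSpace.Opens J1) (i : Fin 5) : SmoothRing N :=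
  of (fun w => w i) (contDiff_apply ..).contDiffOn

lemma eval_coord (i : Fin 5) (w : N) : eval w (coord N i) = w.1 i := rfl

lemma D_coord (i j : Fin 5) : D i (coord N j) = if i = j then 1 else 0 := by
  refine ext_eval fun w => ?_
  rw [coord, eval_D_of, pd_coord]
  split_ifs <;> simp

end SmoothRing

end Smooth

/-! ### Contact equivalences -/

lemma pd_comp {F : ℝ × ℝ → ℝ} {a b : J1 → ℝ} {w : J1} (hF : DifferentiableAt ℝ F (a w, b w))
    (ha : DifferentiableAt ℝ a w) (hb : DifferentiableAt ℝ b w) (i : Fin 5) :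
    pd i (fun v => F (a v, b v)) w =
      Dt F (a w, b w) * pd i a w + Dx F (a w, b w) * pd i b w := by
  have h : HasFDerivAt (fun v => F (a v, b v)) _ w :=
    HasFDerivAt.comp w (f := fun v => (a v, b v)) hF.hasFDerivAt
      (ha.hasFDerivAt.prodMk hb.hasFDerivAt)
  have e : ∀ x y : ℝ, ((x, y) : ℝ × ℝ) = x • (1, 0) + y • (0, 1) := by intro x y; simp
  simp only [pd]
  rw [h.fderiv, Dt_eq_fderiv hF, Dx_eq_fderiv hF]
  simp only [ContinuousLinearMap.comp_apply, ContinuousLinearMap.prod_apply]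
  rw [e (fderiv ℝ a w _), map_add, map_smul, map_smul]
  simp [mul_comm]

/-- The forms in `charT` annihilate the characteristic fields `∂/∂u_x` and
`∂/∂x + u_x ∂/∂u + R ∂/∂u_t`. -/
lemma Equation.apply_of_mem_charT {E : Equation} {w : J1} {ζ : J1 →L[ℝ] ℝ} (h : ζ ∈ E.charT w) :
    ζ (Pi.single 4 1) = 0 ∧
      ζ (Pi.single 1 1) + w 4 * ζ (Pi.single 2 1) + E.rhs w * ζ (Pi.single 3 1) = 0 := by
  refine Submodule.span_induction (p := fun ζ _ => ζ (Pi.single 4 1) = 0 ∧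
      ζ (Pi.single 1 1) + w 4 * ζ (Pi.single 2 1) + E.rhs w * ζ (Pi.single 3 1) = 0)
    ?_ ?_ ?_ ?_ h
  · rintro ζ (rfl | rfl | rfl) <;> simp [contactForm, Equation.formT, dcoord]
  · simp
  · rintro ζ η _ _ ⟨h1, h2⟩ ⟨h3, h4⟩
    simp only [add_apply]
    exact ⟨by linear_combination h1 + h3, by linear_combination h2 + h4⟩
  · rintro c ζ _ ⟨h1, h2⟩
    simp only [smul_apply, smul_eq_mul]
    exact ⟨by linear_combination c * h1, by linear_combination c * h2⟩

/-- The forms in `charX` annihilate the characteristic fields `∂/∂u_t` and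
`∂/∂t + u_t ∂/∂u + R ∂/∂u_x`. -/
lemma Equation.apply_of_mem_charX {E : Equation} {w : J1} {ζ : J1 →L[ℝ] ℝ} (h : ζ ∈ E.charX w) :
    ζ (Pi.single 3 1) = 0 ∧
      ζ (Pi.single 0 1) + w 3 * ζ (Pi.single 2 1) + E.rhs w * ζ (Pi.single 4 1) = 0 := by
  refine Submodule.span_induction (p := fun ζ _ => ζ (Pi.single 3 1) = 0 ∧
      ζ (Pi.single 0 1) + w 3 * ζ (Pi.single 2 1) + E.rhs w * ζ (Pi.single 4 1) = 0)
    ?_ ?_ ?_ ?_ h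
  · rintro ζ (rfl | rfl | rfl) <;> simp [contactForm, Equation.formX, dcoord]
  · simp
  · rintro ζ η _ _ ⟨h1, h2⟩ ⟨h3, h4⟩
    simp only [add_apply]
    exact ⟨by linear_combination h1 + h3, by linear_combination h2 + h4⟩
  · rintro c ζ _ ⟨h1, h2⟩
    simp only [smul_apply, smul_eq_mul]
    exact ⟨by linear_combination c * h1, by linear_combination c * h2⟩

lemma continuous_base : Continuous base := by unfold base; fun_prop

lemma contDiff_base : ContDiff ℝ ∞ base := by unfold base; fun_prop

/-- The point of the plane through `w` parallel to the base that lies over `z`. -/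
def lift (w : J1) (z : ℝ × ℝ) : J1 := ![z.1, z.2, w 2, w 3, w 4]

lemma contDiff_lift (w : J1) : ContDiff ℝ ∞ (lift w) := by
  rw [contDiff_pi]
  intro i
  fin_cases i <;> simp [lift] <;> fun_prop

lemma lift_base (w : J1) : lift w (base w) = w := by
  funext i
  fin_cases i <;> rfl

namespace IsContactEquiv

variable {E E' : Equation} {W : Set J1} {Ψ : J1 → J1} {w : J1}

lemma smooth_apply (h : IsContactEquiv E E' W Ψ) (i : Fin 5) :
    ContDiffOn ℝ ∞ (fun w => Ψ w i) W :=
  contDiffOn_pi.1 h.smooth i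

lemma differentiableAt_apply (h : IsContactEquiv E E' W Ψ) (hw : w ∈ W) (i : Fin 5) :
    DifferentiableAt ℝ (fun w => Ψ w i) w :=
  ((h.smooth_apply i).contDiffAt (h.isOpen.mem_nhds hw)).differentiableAt (by simp)

lemma fderiv_single (h : IsContactEquiv E E' W Ψ) (hw : w ∈ W) (i j : Fin 5) :
    fderiv ℝ Ψ w (Pi.single i 1) j = pd i (fun w => Ψ w j) w := by
  rw [fderiv_pi (fun j => h.differentiableAt_apply hw j)]
  rfl

/-- A nonzero form pulls back to a nonzero form. -/
lemma comp_ne_zero (h : IsContactEquiv E E' W Ψ) (hw : w ∈ W) {ζ : J1 →L[ℝ] ℝ} (hζ : ζ ≠ 0) :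
    ζ.comp (fderiv ℝ Ψ w) ≠ 0 := by
  intro h0
  refine hζ (ContinuousLinearMap.ext fun v => ?_)
  obtain ⟨v', rfl⟩ := (h.bijective w hw).2 v
  exact DFunLike.congr_fun h0 v'

lemma pd_zeroth (h : IsContactEquiv E E' W Ψ) (hw : w ∈ W) :
    pd 4 (fun w => Ψ w 0) w = 0 ∧
      pd 1 (fun w => Ψ w 0) w + w 4 * pd 2 (fun w => Ψ w 0) w
        + E.rhs w * pd 3 (fun w => Ψ w 0) w = 0 := by
  simpa [dcoord, h.fderiv_single hw] using E.apply_of_mem_charT (h.formt w hw)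

lemma pd_first (h : IsContactEquiv E E' W Ψ) (hw : w ∈ W) :
    pd 3 (fun w => Ψ w 1) w = 0 ∧
      pd 0 (fun w => Ψ w 1) w + w 3 * pd 2 (fun w => Ψ w 1) w
        + E.rhs w * pd 4 (fun w => Ψ w 1) w = 0 := by
  simpa [dcoord, h.fderiv_single hw] using E.apply_of_mem_charX (h.formx w hw)

lemma pd_third (h : IsContactEquiv E E' W Ψ) (hw : w ∈ W) :
    pd 4 (fun w => Ψ w 3) w - E'.rhs (Ψ w) * pd 4 (fun w => Ψ w 1) w = 0 ∧
      pd 1 (fun w => Ψ w 3) w - E'.rhs (Ψ w) * pd 1 (fun w => Ψ w 1) w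
        + w 4 * (pd 2 (fun w => Ψ w 3) w - E'.rhs (Ψ w) * pd 2 (fun w => Ψ w 1) w)
        + E.rhs w * (pd 3 (fun w => Ψ w 3) w - E'.rhs (Ψ w) * pd 3 (fun w => Ψ w 1) w) = 0 := by
  simpa [dcoord, Equation.formT, h.fderiv_single hw] using E.apply_of_mem_charT (h.formT w hw)

lemma pd_fourth (h : IsContactEquiv E E' W Ψ) (hw : w ∈ W) :
    pd 3 (fun w => Ψ w 4) w - E'.rhs (Ψ w) * pd 3 (fun w => Ψ w 0) w = 0 := by
  simpa [dcoord, Equation.formX, h.fderiv_single hw] using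
    (E.apply_of_mem_charX (h.formX w hw)).1

/-- The contact condition on the image of `u`; the factor of the contact form is nonzero. -/
lemma pd_second (h : IsContactEquiv E E' W Ψ) (hw : w ∈ W) : ∃ a : ℝ, a ≠ 0 ∧ ∀ i,
    pd i (fun w => Ψ w 2) w - Ψ w 3 * pd i (fun w => Ψ w 0) w - Ψ w 4 * pd i (fun w => Ψ w 1) w
      = a * contactForm w (Pi.single i 1) := by
  obtain ⟨a, ha⟩ := h.contact w hw
  refine ⟨a, ?_, fun i => ?_⟩
  · rintro rfl
    rw [zero_smul] at ha
    refine h.comp_ne_zero hw (fun h0 => ?_) ha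
    have := DFunLike.congr_fun h0 (Pi.single 2 1)
    simp [contactForm, dcoord] at this
  · have := DFunLike.congr_fun ha (Pi.single i 1)
    simpa [contactForm, dcoord, h.fderiv_single hw] using this

end IsContactEquiv

/-- Derivatives of a function of `(t, x)` along the coordinates of the jet space. -/
lemma pd_comp_base {F : ℝ × ℝ → ℝ} {w : J1} (hF : DifferentiableAt ℝ F (base w)) (i : Fin 5) :
    pd i (fun v => F (base v)) w =
      Dt F (base w) * (if i = 0 then 1 else 0) + Dx F (base w) * (if i = 1 then 1 else 0) := by
  have := pd_comp (F := F) (a := fun v => v 0) (b := fun v => v 1) (w := w) hF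
    (by fun_prop) (by fun_prop) i
  simp only [pd_coord] at this
  exact this

section

variable {N : TopologicalSpace.Opens J1} {E : Equation} {F : ℝ × ℝ → ℝ}

open SmoothRing

lemma smooth_comp_base (hN : ∀ w ∈ N, base w ∈ E.dom) (hF : ContDiffOn ℝ ∞ F E.dom) :
    ContDiffOn ℝ ∞ (fun w => F (base w)) N :=
  hF.comp contDiff_base.contDiffOn hN

/-- A function of `(t, x)` on the domain of `E`, as an element of the ring of smooth functions. -/
def SmoothRing.ofBase (hN : ∀ w ∈ N, base w ∈ E.dom) (hF : ContDiffOn ℝ ∞ F E.dom) :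
    SmoothRing N :=
  of (fun w => F (base w)) (smooth_comp_base hN hF)

lemma SmoothRing.eval_ofBase (hN : ∀ w ∈ N, base w ∈ E.dom) (hF : ContDiffOn ℝ ∞ F E.dom)
    (w : N) : eval w (ofBase hN hF) = F (base w) := rfl

lemma SmoothRing.eval_D_ofBase (hN : ∀ w ∈ N, base w ∈ E.dom) (hF : ContDiffOn ℝ ∞ F E.dom)
    (i : Fin 5) (w : N) : eval w (D i (ofBase hN hF)) =
      Dt F (base w) * (if i = 0 then 1 else 0) + Dx F (base w) * (if i = 1 then 1 else 0) := by
  rw [ofBase, eval_D_of]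
  exact pd_comp_base (differentiableAt_of_smooth E.isOpen_dom hF (hN w w.2)) i

lemma SmoothRing.D_ofBase_eq_zero (hN : ∀ w ∈ N, base w ∈ E.dom)
    (hF : ContDiffOn ℝ ∞ F E.dom) {i : Fin 5} (h0 : i ≠ 0) (h1 : i ≠ 1) :
    D i (ofBase hN hF) = 0 :=
  ext_eval fun w => by rw [eval_D_ofBase]; simp [h0, h1]

/-- A first integral of the characteristic system `du - u_t dt - u_x dx = du_t - R dx = dt = 0`
does not depend on `u_t` unless `K = 0`. -/
lemma firstIntegral_charT (hN : ∀ w ∈ N, base w ∈ E.dom) {f : J1 → ℝ} (hf : ContDiffOn ℝ ∞ f N)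
    (h : ∀ w ∈ N, pd 4 f w = 0 ∧ pd 1 f w + w 4 * pd 2 f w + E.rhs w * pd 3 f w = 0) :
    ∀ w ∈ N, pd 2 f w + E.X (base w) * pd 3 f w = 0 ∧ E.K (base w) * pd 3 f w = 0 := by
  have h0 {F : ℝ × ℝ → ℝ} (hF : ContDiffOn ℝ ∞ F E.dom) : D 2 (ofBase hN hF) = 0 ∧
      D 3 (ofBase hN hF) = 0 ∧ D 4 (ofBase hN hF) = 0 :=
    ⟨D_ofBase_eq_zero hN hF (by decide) (by decide),
      D_ofBase_eq_zero hN hF (by decide) (by decide),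
      D_ofBase_eq_zero hN hF (by decide) (by decide)⟩
  have h4 : D 4 (of f hf) = 0 := ext_eval fun w => by
    rw [eval_D_of, (h w w.2).1, map_zero]
  have hY : D 1 (of f hf) + coord N 4 * D 2 (of f hf) + (ofBase hN E.smooth_T * coord N 3 +
      ofBase hN E.smooth_X * coord N 4 + ofBase hN E.smooth_U * coord N 2) * D 3 (of f hf) = 0 :=
    ext_eval fun w => by
      simp only [map_add, map_mul, map_zero, eval_D_of, eval_coord, eval_ofBase]
      exact (h w w.2).2
  obtain ⟨h1, h2⟩ := firstIntegral_algebra (D 1) (D 2) (D 3) (D 4) (D_comm 4 1) (D_comm 4 2)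
    (D_comm 4 3) (D_comm 2 1) (D_comm 3 1) (D_comm 3 2)
    (by simp [D_coord]) (by simp [D_coord]) (by simp [D_coord]) (by simp [D_coord])
    (by simp [D_coord]) (by simp [D_coord]) (by simp [D_coord]) (by simp [D_coord])
    (by simp [D_coord]) (h0 E.smooth_T) (h0 E.smooth_X) (h0 E.smooth_U) h4 hY
  intro w hw
  have e1 := congrArg (eval ⟨w, hw⟩) h1
  have e2 := congrArg (eval ⟨w, hw⟩) h2
  simp only [map_add, map_mul, map_neg, map_zero, eval_D_of, eval_ofBase, eval_D_ofBase] at e1 e2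
  refine ⟨e1, ?_⟩
  simpa [Equation.K] using e2

/-- A first integral of the characteristic system `du - u_t dt - u_x dx = du_x - R dt = dx = 0`
does not depend on `u_x` unless `H = 0`. -/
lemma firstIntegral_charX (hN : ∀ w ∈ N, base w ∈ E.dom) {f : J1 → ℝ} (hf : ContDiffOn ℝ ∞ f N)
    (h : ∀ w ∈ N, pd 3 f w = 0 ∧ pd 0 f w + w 3 * pd 2 f w + E.rhs w * pd 4 f w = 0) :
    ∀ w ∈ N, pd 2 f w + E.T (base w) * pd 4 f w = 0 ∧ E.H (base w) * pd 4 f w = 0 := by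
  have h0 {F : ℝ × ℝ → ℝ} (hF : ContDiffOn ℝ ∞ F E.dom) : D 2 (ofBase hN hF) = 0 ∧
      D 4 (ofBase hN hF) = 0 ∧ D 3 (ofBase hN hF) = 0 :=
    ⟨D_ofBase_eq_zero hN hF (by decide) (by decide),
      D_ofBase_eq_zero hN hF (by decide) (by decide),
      D_ofBase_eq_zero hN hF (by decide) (by decide)⟩
  have h4 : D 3 (of f hf) = 0 := ext_eval fun w => by
    rw [eval_D_of, (h w w.2).1, map_zero]
  have hY : D 0 (of f hf) + coord N 3 * D 2 (of f hf) + (ofBase hN E.smooth_X * coord N 4 +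
      ofBase hN E.smooth_T * coord N 3 + ofBase hN E.smooth_U * coord N 2) * D 4 (of f hf) = 0 :=
    ext_eval fun w => by
      simp only [map_add, map_mul, map_zero, eval_D_of, eval_coord, eval_ofBase]
      rw [← (h w w.2).2, Equation.rhs]
      ring
  obtain ⟨h1, h2⟩ := firstIntegral_algebra (D 0) (D 2) (D 4) (D 3) (D_comm 3 0) (D_comm 3 2)
    (D_comm 3 4) (D_comm 2 0) (D_comm 4 0) (D_comm 4 2)
    (by simp [D_coord]) (by simp [D_coord]) (by simp [D_coord]) (by simp [D_coord])
    (by simp [D_coord]) (by simp [D_coord]) (by simp [D_coord]) (by simp [D_coord])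
    (by simp [D_coord]) (h0 E.smooth_X) (h0 E.smooth_T) (h0 E.smooth_U) h4 hY
  intro w hw
  have e1 := congrArg (eval ⟨w, hw⟩) h1
  have e2 := congrArg (eval ⟨w, hw⟩) h2
  simp only [map_add, map_mul, map_neg, map_zero, eval_D_of, eval_ofBase, eval_D_ofBase] at e1 e2
  refine ⟨e1, ?_⟩
  simpa [Equation.H, mul_comm (E.X (base w))] using e2

end

open SmoothRing

namespace IsContactEquiv

variable {E E' : Equation} {W : Set J1} {Ψ : J1 → J1} {w : J1} {N : TopologicalSpace.Opens J1}

/-- If the image of `t` depends on `t` only and that of `x` on `x` only, then `H` and `K` are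
multiplied by the Jacobian of the change of `(t, x)`. -/
lemma laplace_mul (h : IsContactEquiv E E' W Ψ) (hNW : (N : Set J1) ⊆ W)
    (hτ : ∀ w ∈ N, pd 1 (fun w => Ψ w 0) w = 0 ∧ pd 2 (fun w => Ψ w 0) w = 0 ∧
      pd 3 (fun w => Ψ w 0) w = 0 ∧ pd 4 (fun w => Ψ w 0) w = 0)
    (hξ : ∀ w ∈ N, pd 0 (fun w => Ψ w 1) w = 0 ∧ pd 2 (fun w => Ψ w 1) w = 0 ∧
      pd 3 (fun w => Ψ w 1) w = 0 ∧ pd 4 (fun w => Ψ w 1) w = 0) :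
    ∀ w ∈ N,
      E.H (base w) = pd 0 (fun w => Ψ w 0) w * pd 1 (fun w => Ψ w 1) w * E'.H (base (Ψ w)) ∧
      E.K (base w) = pd 0 (fun w => Ψ w 0) w * pd 1 (fun w => Ψ w 1) w * E'.K (base (Ψ w)) := by
  have hN : ∀ w ∈ N, base w ∈ E.dom := fun w hw => h.source w (hNW hw)
  have hsm (i : Fin 5) : ContDiffOn ℝ ∞ (fun w => Ψ w i) N := (h.smooth_apply i).mono hNW
  have hs' {F : ℝ × ℝ → ℝ} (hF : ContDiffOn ℝ ∞ F E'.dom) :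
      ContDiffOn ℝ ∞ (fun w => F (Ψ w 0, Ψ w 1)) N :=
    hF.comp ((hsm 0).prodMk (hsm 1)) fun w hw => h.target w (hNW hw)
  have hd' {F : ℝ × ℝ → ℝ} (hF : ContDiffOn ℝ ∞ F E'.dom) (i : Fin 5) (w : N) :
      pd i (fun w => F (Ψ w 0, Ψ w 1)) w = Dt F (Ψ w 0, Ψ w 1) * pd i (fun w => Ψ w 0) w +
        Dx F (Ψ w 0, Ψ w 1) * pd i (fun w => Ψ w 1) w :=
    pd_comp (differentiableAt_of_smooth E'.isOpen_dom hF (h.target w (hNW w.2)))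
      (h.differentiableAt_apply (hNW w.2) 0) (h.differentiableAt_apply (hNW w.2) 1) i
  have h0 {F : ℝ × ℝ → ℝ} (hF : ContDiffOn ℝ ∞ F E.dom) : D 2 (ofBase hN hF) = 0 ∧
      D 3 (ofBase hN hF) = 0 ∧ D 4 (ofBase hN hF) = 0 :=
    ⟨D_ofBase_eq_zero hN hF (by decide) (by decide),
      D_ofBase_eq_zero hN hF (by decide) (by decide),
      D_ofBase_eq_zero hN hF (by decide) (by decide)⟩
  have h0' {F : ℝ × ℝ → ℝ} (hF : ContDiffOn ℝ ∞ F E'.dom) : D 2 (of _ (hs' hF)) = 0 ∧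
      D 3 (of _ (hs' hF)) = 0 ∧ D 4 (of _ (hs' hF)) = 0 := by
    refine ⟨ext_eval fun w => ?_, ext_eval fun w => ?_, ext_eval fun w => ?_⟩ <;>
      rw [eval_D_of, hd' hF] <;> simp [hτ w w.2, hξ w w.2]
  have hτ' : D 1 (of _ (hsm 0)) = 0 ∧ D 2 (of _ (hsm 0)) = 0 ∧ D 3 (of _ (hsm 0)) = 0 ∧
      D 4 (of _ (hsm 0)) = 0 := by
    refine ⟨ext_eval fun w => ?_, ext_eval fun w => ?_, ext_eval fun w => ?_,
      ext_eval fun w => ?_⟩ <;> simp [eval_D_of, hτ w w.2]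
  have hξ' : D 0 (of _ (hsm 1)) = 0 ∧ D 2 (of _ (hsm 1)) = 0 ∧ D 3 (of _ (hsm 1)) = 0 ∧
      D 4 (of _ (hsm 1)) = 0 := by
    refine ⟨ext_eval fun w => ?_, ext_eval fun w => ?_, ext_eval fun w => ?_,
      ext_eval fun w => ?_⟩ <;> simp [eval_D_of, hξ w w.2]
  -- the contact condition: `∂υ/∂u` is the factor of the contact form
  have hυ (w : N) : pd 2 (fun w => Ψ w 2) w ≠ 0 ∧
      pd 3 (fun w => Ψ w 2) w = 0 ∧ pd 4 (fun w => Ψ w 2) w = 0 ∧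
      pd 0 (fun w => Ψ w 2) w = Ψ w 3 * pd 0 (fun w => Ψ w 0) w
        - pd 2 (fun w => Ψ w 2) w * w.1 3 ∧
      pd 1 (fun w => Ψ w 2) w = Ψ w 4 * pd 1 (fun w => Ψ w 1) w
        - pd 2 (fun w => Ψ w 2) w * w.1 4 := by
    obtain ⟨a, ha, hi⟩ := h.pd_second (hNW w.2)
    obtain ⟨e1, e2, e3, e4⟩ := hτ w w.2
    obtain ⟨f1, f2, f3, f4⟩ := hξ w w.2
    have i0 := hi 0
    have i1 := hi 1
    have i2 := hi 2
    have i3 := hi 3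
    have i4 := hi 4
    simp [contactForm, dcoord, e1, e2, e3, e4, f1, f2, f3, f4] at i0 i1 i2 i3 i4
    rw [i2]
    exact ⟨ha, i3, i4, by linear_combination i0, by linear_combination i1⟩
  have hA := laplace_algebra (D 0) (D 1) (D 2) (D 3) (D 4) (D_comm 0 1) (D_comm 2 0) (D_comm 2 1)
    (D_comm 3 0) (D_comm 3 1) (D_comm 3 2) (D_comm 4 0) (D_comm 4 1) (D_comm 4 2)
    (u := coord N 2) (p := coord N 3) (q := coord N 4) (υ := of _ (hsm 2)) (π := of _ (hsm 3))
    (κ := of _ (hsm 4)) (T't := of _ (hs' (smooth_Dt E'.isOpen_dom E'.smooth_T)))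
    (X'x := of _ (hs' (smooth_Dx E'.isOpen_dom E'.smooth_X)))
    (by simp [D_coord]) (by simp [D_coord]) (by simp [D_coord]) (by simp [D_coord])
    (by simp [D_coord]) (by simp [D_coord]) (by simp [D_coord]) (by simp [D_coord])
    (by simp [D_coord]) (h0 E.smooth_T) (h0 E.smooth_X) (h0 E.smooth_U)
    (h0' E'.smooth_T) (h0' E'.smooth_X) (h0' E'.smooth_U)
    (ext_eval fun w => by
      rw [eval_D_of, hd' E'.smooth_T, (hξ w w.2).1, map_mul, eval_of, eval_D_of, mul_zero,
        add_zero])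
    (ext_eval fun w => by
      rw [eval_D_of, hd' E'.smooth_X, (hτ w w.2).1, map_mul, eval_of, eval_D_of, mul_zero,
        zero_add])
    hτ' hξ'
    (ext_eval fun w => by rw [eval_D_of, map_zero, (hυ w).2.1])
    (ext_eval fun w => by rw [eval_D_of, map_zero, (hυ w).2.2.1])
    (ext_eval fun w => by
      simp only [map_mul, map_sub, eval_D_of, eval_of, eval_coord]
      exact (hυ w).2.2.2.1)
    (ext_eval fun w => by
      simp only [map_mul, map_sub, eval_D_of, eval_of, eval_coord]
      exact (hυ w).2.2.2.2)
    (ext_eval fun w => by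
      have := (h.pd_third (hNW w.2)).1
      rw [(hξ w w.2).2.2.2] at this
      rw [eval_D_of, map_zero]
      linear_combination this)
    (ext_eval fun w => by
      have := h.pd_fourth (hNW w.2)
      rw [(hτ w w.2).2.2.1] at this
      rw [eval_D_of, map_zero]
      linear_combination this)
    (ext_eval fun w => by
      have := (h.pd_third (hNW w.2)).2
      rw [(hξ w w.2).2.1, (hξ w w.2).2.2.1] at this
      simp only [map_mul, map_add, eval_D_of, eval_of, eval_coord, eval_ofBase]
      simp only [Equation.rhs, base] at this ⊢
      linear_combination this)
  intro w hw
  have e1 := congrArg (eval ⟨w, hw⟩) hA.1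
  have e2 := congrArg (eval ⟨w, hw⟩) hA.2
  simp only [map_add, map_mul, map_neg, eval_D_of, eval_of, eval_ofBase, eval_D_ofBase]
    at e1 e2
  have hσ := (hυ ⟨w, hw⟩).1
  constructor
  · have := mul_left_cancel₀ hσ e1
    simpa [Equation.H, base] using this
  · have := mul_left_cancel₀ hσ e2
    simpa [Equation.K, base] using this

end IsContactEquiv

/-- The change of variables `(t, x) ↦ (φ t, ψ x)` on the rectangle `A ×ˢ B` multiplies the Laplace
semi-invariants by its Jacobian. -/
structure IsBaseChange (E E' : Equation) (A B : Set ℝ) (φ ψ : ℝ → ℝ) : Prop where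
  isOpen_A : IsOpen A
  isOpen_B : IsOpen B
  smooth_φ : ContDiffOn ℝ ∞ φ A
  smooth_ψ : ContDiffOn ℝ ∞ ψ B
  deriv_φ_ne : ∀ t ∈ A, deriv φ t ≠ 0
  deriv_ψ_ne : ∀ x ∈ B, deriv ψ x ≠ 0
  source : ∀ t ∈ A, ∀ x ∈ B, (t, x) ∈ E.dom
  target : ∀ t ∈ A, ∀ x ∈ B, (φ t, ψ x) ∈ E'.dom
  H_eq : ∀ t ∈ A, ∀ x ∈ B, E.H (t, x) = deriv φ t * deriv ψ x * E'.H (φ t, ψ x)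
  K_eq : ∀ t ∈ A, ∀ x ∈ B, E.K (t, x) = deriv φ t * deriv ψ x * E'.K (φ t, ψ x)

lemma hasDerivAt_comp_lift_fst {f : J1 → ℝ} (w : J1) {z : ℝ × ℝ}
    (hf : DifferentiableAt ℝ f (lift w z)) :
    HasDerivAt (fun s => f (lift w (s, z.2))) (pd 0 f (lift w z)) z.1 := by
  refine HasFDerivAt.comp_hasDerivAt (f := fun s => lift w (s, z.2)) z.1 hf.hasFDerivAt ?_
  refine hasDerivAt_pi.2 fun i => ?_
  fin_cases i
  · simpa [lift] using hasDerivAt_id' z.1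
  all_goals simpa [lift] using hasDerivAt_const z.1 _

lemma hasDerivAt_comp_lift_snd {f : J1 → ℝ} (w : J1) {z : ℝ × ℝ}
    (hf : DifferentiableAt ℝ f (lift w z)) :
    HasDerivAt (fun y => f (lift w (z.1, y))) (pd 1 f (lift w z)) z.2 := by
  refine HasFDerivAt.comp_hasDerivAt (f := fun y => lift w (z.1, y)) z.2 hf.hasFDerivAt ?_
  refine hasDerivAt_pi.2 fun i => ?_
  fin_cases i
  · simpa [lift] using hasDerivAt_const z.2 z.1
  · simpa [lift] using hasDerivAt_id' z.2
  all_goals simpa [lift] using hasDerivAt_const z.2 _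

lemma lift_mem_ball {w : J1} {r t x : ℝ} (hr : 0 < r) (ht : t ∈ Metric.ball (w 0) r)
    (hx : x ∈ Metric.ball (w 1) r) : lift w (t, x) ∈ Metric.ball w r := by
  rw [Metric.mem_ball, dist_pi_lt_iff hr]
  intro i
  fin_cases i
  · exact ht
  · exact hx
  all_goals simpa [lift] using hr

lemma eq_zero_of_apply_single {ζ : J1 →L[ℝ] ℝ} (h : ∀ i, ζ (Pi.single i 1) = 0) : ζ = 0 := by
  refine ContinuousLinearMap.coe_injective ((Pi.basisFun ℝ (Fin 5)).ext fun i => ?_)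
  simpa using h i

namespace IsContactEquiv

variable {E E' : Equation} {W : Set J1} {Ψ : J1 → J1} {w₀ : J1}

/-- Where `H` is nonzero and `K` does not vanish on any open set, a contact equivalence is, on
the base, a change `(t, x) ↦ (φ t, ψ x)`, and `H` and `K` are multiplied by its Jacobian. -/
theorem exists_isBaseChange (h : IsContactEquiv E E' W Ψ) (hw₀ : w₀ ∈ W)
    (hH : E.H (base w₀) ≠ 0) (hK : ∀ᶠ z in 𝓝 (base w₀), ∃ᶠ y in 𝓝 z, E.K y ≠ 0) :
    ∃ (A B : Set ℝ) (φ ψ : ℝ → ℝ), IsBaseChange E E' A B φ ψ ∧ w₀ 0 ∈ A ∧ w₀ 1 ∈ B ∧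
      base (Ψ w₀) = (φ (w₀ 0), ψ (w₀ 1)) := by
  have hH' : ∀ᶠ z in 𝓝 (base w₀), E.H z ≠ 0 :=
    (E.smooth_H.continuousOn.continuousAt
      (E.isOpen_dom.mem_nhds (h.source w₀ hw₀))).eventually_ne hH
  obtain ⟨r, hr, hball⟩ := Metric.eventually_nhds_iff_ball.1
    ((show ∀ᶠ w in 𝓝 w₀, w ∈ W from h.isOpen.mem_nhds hw₀).and
      ((continuous_base.tendsto w₀).eventually (hH'.and hK)))
  obtain ⟨N, hNr⟩ : ∃ N : TopologicalSpace.Opens J1, (N : Set J1) = Metric.ball w₀ r :=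
    ⟨⟨_, Metric.isOpen_ball⟩, rfl⟩
  have hN : ∀ w ∈ N, w ∈ W ∧ E.H (base w) ≠ 0 ∧ ∃ᶠ y in 𝓝 (base w), E.K y ≠ 0 := fun w hw =>
    hball w (by rwa [← hNr])
  have hNW : (N : Set J1) ⊆ W := fun w hw => (hN w hw).1
  have hNE : ∀ w ∈ N, base w ∈ E.dom := fun w hw => h.source w (hNW hw)
  have hsm (i : Fin 5) : ContDiffOn ℝ ∞ (fun w => Ψ w i) N := (h.smooth_apply i).mono hNW
  -- the image of `t` is a function of `t` alone
  have hτ : ∀ w ∈ N, pd 1 (fun w => Ψ w 0) w = 0 ∧ pd 2 (fun w => Ψ w 0) w = 0 ∧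
      pd 3 (fun w => Ψ w 0) w = 0 ∧ pd 4 (fun w => Ψ w 0) w = 0 := by
    have hint := firstIntegral_charT hNE (hsm 0) fun w hw => h.pd_zeroth (hNW hw)
    have h3 : ∀ w ∈ N, pd 3 (fun w => Ψ w 0) w = 0 := by
      intro w hw
      by_contra hne
      have hev : ∀ᶠ v in 𝓝 w, E.K (base v) = 0 := by
        filter_upwards [N.isOpen.mem_nhds hw,
          ((smooth_pd (hsm 0) 3).continuousOn.continuousAt
            (N.isOpen.mem_nhds hw)).eventually_ne hne] with v hv hv'
        exact (mul_eq_zero.1 (hint v hv).2).resolve_right hv'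
      have htend : Tendsto (lift w) (𝓝 (base w)) (𝓝 w) := by
        have := (contDiff_lift w).continuous.tendsto (base w)
        rwa [lift_base] at this
      exact (hN w hw).2.2 ((htend.eventually hev).mono fun z hz => not_not.2 hz)
    intro w hw
    obtain ⟨h4, h1⟩ := h.pd_zeroth (hNW hw)
    have h2 := (hint w hw).1
    rw [h3 w hw, mul_zero, add_zero] at h2
    rw [h3 w hw, h2, mul_zero, mul_zero, add_zero, add_zero] at h1
    exact ⟨h1, h2, h3 w hw, h4⟩
  -- the image of `x` is a function of `x` alone
  have hξ : ∀ w ∈ N, pd 0 (fun w => Ψ w 1) w = 0 ∧ pd 2 (fun w => Ψ w 1) w = 0 ∧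
      pd 3 (fun w => Ψ w 1) w = 0 ∧ pd 4 (fun w => Ψ w 1) w = 0 := by
    intro w hw
    obtain ⟨h2, h4⟩ := firstIntegral_charX hNE (hsm 1) (fun w hw => h.pd_first (hNW hw)) w hw
    obtain ⟨h3, h0⟩ := h.pd_first (hNW hw)
    replace h4 := (mul_eq_zero.1 h4).resolve_left (hN w hw).2.1
    rw [h4, mul_zero, add_zero] at h2
    rw [h4, h2, mul_zero, mul_zero, add_zero, add_zero] at h0
    exact ⟨h0, h2, h3, h4⟩
  have hτ0 : ∀ w ∈ N, pd 0 (fun w => Ψ w 0) w ≠ 0 := fun w hw h0 => by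
    obtain ⟨h1, h2, h3, h4⟩ := hτ w hw
    refine h.comp_ne_zero (hNW hw) (ζ := dcoord 0) (fun he => ?_)
      (eq_zero_of_apply_single fun i => ?_)
    · simpa [dcoord] using DFunLike.congr_fun he (Pi.single 0 1)
    · change fderiv ℝ Ψ w (Pi.single i 1) 0 = 0
      rw [h.fderiv_single (hNW hw)]
      fin_cases i <;> assumption
  have hξ1 : ∀ w ∈ N, pd 1 (fun w => Ψ w 1) w ≠ 0 := fun w hw h1 => by
    obtain ⟨h0, h2, h3, h4⟩ := hξ w hw
    refine h.comp_ne_zero (hNW hw) (ζ := dcoord 1) (fun he => ?_)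
      (eq_zero_of_apply_single fun i => ?_)
    · simpa [dcoord] using DFunLike.congr_fun he (Pi.single 1 1)
    · change fderiv ℝ Ψ w (Pi.single i 1) 1 = 0
      rw [h.fderiv_single (hNW hw)]
      fin_cases i <;> assumption
  have hmul := h.laplace_mul hNW hτ hξ
  have hlift {t x : ℝ} (ht : t ∈ Metric.ball (w₀ 0) r) (hx : x ∈ Metric.ball (w₀ 1) r) :
      lift w₀ (t, x) ∈ N := by
    rw [← SetLike.mem_coe, hNr]
    exact lift_mem_ball hr ht hx
  have h0 := Metric.mem_ball_self hr (x := w₀ 0)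
  have h1 := Metric.mem_ball_self hr (x := w₀ 1)
  let φ : ℝ → ℝ := fun t => Ψ (lift w₀ (t, w₀ 1)) 0
  let ψ : ℝ → ℝ := fun x => Ψ (lift w₀ (w₀ 0, x)) 1
  have hdiff {t x : ℝ} (ht : t ∈ Metric.ball (w₀ 0) r) (hx : x ∈ Metric.ball (w₀ 1) r)
      (i : Fin 5) : DifferentiableAt ℝ (fun w => Ψ w i) (lift w₀ (t, x)) :=
    h.differentiableAt_apply (hNW (hlift ht hx)) i
  have hφ : ∀ t ∈ Metric.ball (w₀ 0) r, ∀ x ∈ Metric.ball (w₀ 1) r,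
      Ψ (lift w₀ (t, x)) 0 = φ t := by
    intro t ht x hx
    have hd : ∀ y ∈ Metric.ball (w₀ 1) r,
        HasDerivAt (fun y => Ψ (lift w₀ (t, y)) 0) 0 y := fun y hy => by
      have := hasDerivAt_comp_lift_snd w₀ (z := (t, y)) (hdiff ht hy 0)
      rwa [(hτ _ (hlift ht hy)).1] at this
    exact Metric.isOpen_ball.is_const_of_deriv_eq_zero
      (convex_ball (w₀ 1) r).isPreconnected
      (fun y hy => (hd y hy).differentiableAt.differentiableWithinAt)
      (fun y hy => (hd y hy).deriv) hx h1
  have hψ : ∀ t ∈ Metric.ball (w₀ 0) r, ∀ x ∈ Metric.ball (w₀ 1) r,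
      Ψ (lift w₀ (t, x)) 1 = ψ x := by
    intro t ht x hx
    have hd : ∀ s ∈ Metric.ball (w₀ 0) r,
        HasDerivAt (fun s => Ψ (lift w₀ (s, x)) 1) 0 s := fun s hs => by
      have := hasDerivAt_comp_lift_fst w₀ (z := (s, x)) (hdiff hs hx 1)
      rwa [(hξ _ (hlift hs hx)).1] at this
    exact Metric.isOpen_ball.is_const_of_deriv_eq_zero
      (convex_ball (w₀ 0) r).isPreconnected
      (fun s hs => (hd s hs).differentiableAt.differentiableWithinAt)
      (fun s hs => (hd s hs).deriv) ht h0
  have hφ' : ∀ t ∈ Metric.ball (w₀ 0) r, ∀ x ∈ Metric.ball (w₀ 1) r,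
      deriv φ t = pd 0 (fun w => Ψ w 0) (lift w₀ (t, x)) := fun t ht x hx =>
    ((hasDerivAt_comp_lift_fst w₀ (z := (t, x)) (hdiff ht hx 0)).congr_of_eventuallyEq
      (eventually_of_mem (Metric.isOpen_ball.mem_nhds ht) fun s hs =>
        (hφ s hs x hx).symm)).deriv
  have hψ' : ∀ t ∈ Metric.ball (w₀ 0) r, ∀ x ∈ Metric.ball (w₀ 1) r,
      deriv ψ x = pd 1 (fun w => Ψ w 1) (lift w₀ (t, x)) := fun t ht x hx =>
    ((hasDerivAt_comp_lift_snd w₀ (z := (t, x)) (hdiff ht hx 1)).congr_of_eventuallyEq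
      (eventually_of_mem (Metric.isOpen_ball.mem_nhds hx) fun y hy =>
        (hψ t ht y hy).symm)).deriv
  have hbase : ∀ t ∈ Metric.ball (w₀ 0) r, ∀ x ∈ Metric.ball (w₀ 1) r,
      base (Ψ (lift w₀ (t, x))) = (φ t, ψ x) := fun t ht x hx =>
    Prod.ext (hφ t ht x hx) (hψ t ht x hx)
  refine ⟨Metric.ball (w₀ 0) r, Metric.ball (w₀ 1) r, φ, ψ, ?_, h0, h1, ?_⟩
  · refine ⟨Metric.isOpen_ball, Metric.isOpen_ball, ?_, ?_, fun t ht => ?_, fun x hx => ?_,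
      fun t ht x hx => hNE _ (hlift ht hx), fun t ht x hx => ?_, fun t ht x hx => ?_,
      fun t ht x hx => ?_⟩
    · exact (hsm 0).comp (t := (N : Set J1)) ((contDiff_lift w₀).comp
        (contDiff_prodMk_left (w₀ 1))).contDiffOn fun t ht => hlift ht h1
    · exact (hsm 1).comp (t := (N : Set J1)) ((contDiff_lift w₀).comp
        (contDiff_prodMk_right (w₀ 0))).contDiffOn fun x hx => hlift h0 hx
    · rw [hφ' t ht _ h1]
      exact hτ0 _ (hlift ht h1)
    · rw [hψ' _ h0 x hx]
      exact hξ1 _ (hlift h0 hx)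
    · rw [← hbase t ht x hx]
      exact h.target _ (hNW (hlift ht hx))
    · rw [hφ' t ht x hx, hψ' t ht x hx, ← hbase t ht x hx]
      exact (hmul _ (hlift ht hx)).1
    · rw [hφ' t ht x hx, hψ' t ht x hx, ← hbase t ht x hx]
      exact (hmul _ (hlift ht hx)).2
  · have := hbase _ h0 _ h1
    rwa [show lift w₀ (w₀ 0, w₀ 1) = w₀ from lift_base w₀] at this

end IsContactEquiv

/-! ### Differential polynomials in the coefficients -/

/-- The differential polynomials of order at most `k` in the coefficients of an equation, up to
equality on the domain of the equation. -/
inductive IsJetPolynomial (k : ℕ) : (Equation → ℝ × ℝ → ℝ) → Prop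
  | coeff (a : Fin 3) (i j : ℕ) (hij : i + j ≤ k) :
      IsJetPolynomial k (fun E => Dt^[i] (Dx^[j] (E.coeff a)))
  | neg {f} : IsJetPolynomial k f → IsJetPolynomial k (fun E z => -f E z)
  | add {f g} : IsJetPolynomial k f → IsJetPolynomial k g →
      IsJetPolynomial k (fun E z => f E z + g E z)
  | mul {f g} : IsJetPolynomial k f → IsJetPolynomial k g →
      IsJetPolynomial k (fun E z => f E z * g E z)
  | congr {f g} : IsJetPolynomial k f → (∀ E : Equation, EqOn (g E) (f E) E.dom) →
      IsJetPolynomial k g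

namespace IsJetPolynomial

variable {k : ℕ} {f : Equation → ℝ × ℝ → ℝ}

lemma smooth (h : IsJetPolynomial k f) (E : Equation) : ContDiffOn ℝ ∞ (f E) E.dom := by
  induction h with
  | coeff a i j _ =>
    exact smooth_iterate_Dt E.isOpen_dom (smooth_iterate_Dx E.isOpen_dom (E.smooth_coeff a) j) i
  | neg _ ih => exact ih.neg
  | add _ _ ih₁ ih₂ => exact ih₁.add ih₂
  | mul _ _ ih₁ ih₂ => exact ih₁.mul ih₂
  | congr _ he ih => exact ih.congr (he E)

lemma mono {l : ℕ} (h : IsJetPolynomial k f) (hkl : k ≤ l) : IsJetPolynomial l f := by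
  induction h with
  | coeff a i j hij => exact coeff a i j (hij.trans hkl)
  | neg _ ih => exact ih.neg
  | add _ _ ih₁ ih₂ => exact ih₁.add ih₂
  | mul _ _ ih₁ ih₂ => exact ih₁.mul ih₂
  | congr _ he ih => exact ih.congr he

/-- A differential polynomial is a smooth function of the jet. -/
lemma exists_contDiff (h : IsJetPolynomial k f) : ∃ F : Jet k → ℝ, ContDiff ℝ ∞ F ∧
    ∀ E : Equation, ∀ z ∈ E.dom, f E z = F (E.jet k z) := by
  induction h with
  | coeff a i j hij =>
    refine ⟨fun J => J.2.2 a ⟨(⟨i, by omega⟩, ⟨j, by omega⟩), hij⟩, ?_, fun _ _ _ => rfl⟩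
    fun_prop
  | neg _ ih =>
    obtain ⟨F, hF, hF'⟩ := ih
    exact ⟨fun J => -F J, hF.neg, fun E z hz => by simp only [hF' E z hz]⟩
  | add _ _ ih₁ ih₂ =>
    obtain ⟨F, hF, hF'⟩ := ih₁
    obtain ⟨G, hG, hG'⟩ := ih₂
    exact ⟨fun J => F J + G J, hF.add hG, fun E z hz => by
      simp only [hF' E z hz, hG' E z hz]⟩
  | mul _ _ ih₁ ih₂ =>
    obtain ⟨F, hF, hF'⟩ := ih₁
    obtain ⟨G, hG, hG'⟩ := ih₂
    exact ⟨fun J => F J * G J, hF.mul hG, fun E z hz => by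
      simp only [hF' E z hz, hG' E z hz]⟩
  | congr _ he ih =>
    obtain ⟨F, hF, hF'⟩ := ih
    exact ⟨F, hF, fun E z hz => by rw [he E hz, hF' E z hz]⟩

lemma Dt (h : IsJetPolynomial k f) : IsJetPolynomial (k + 1) (fun E => LinHyp.Dt (f E)) := by
  induction h with
  | coeff a i j hij =>
    refine (coeff a (i + 1) j (by omega)).congr fun E z _ => ?_
    rw [Function.iterate_succ_apply']
  | @neg f hf ih =>
    refine ih.neg.congr fun E z hz => ?_
    exact (hasDerivAt_Dt (differentiableAt_of_smooth E.isOpen_dom (hf.smooth E) hz)).neg.deriv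
  | @add f g hf hg ih₁ ih₂ =>
    refine (ih₁.add ih₂).congr fun E z hz => ?_
    exact ((hasDerivAt_Dt (differentiableAt_of_smooth E.isOpen_dom (hf.smooth E) hz)).add
      (hasDerivAt_Dt (differentiableAt_of_smooth E.isOpen_dom (hg.smooth E) hz))).deriv
  | @mul f g hf hg ih₁ ih₂ =>
    refine ((ih₁.mul (hg.mono k.le_succ)).add ((hf.mono k.le_succ).mul ih₂)).congr
      fun E z hz => ?_
    exact ((hasDerivAt_Dt (differentiableAt_of_smooth E.isOpen_dom (hf.smooth E) hz)).mul
      (hasDerivAt_Dt (differentiableAt_of_smooth E.isOpen_dom (hg.smooth E) hz))).deriv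
  | congr _ he ih => exact ih.congr fun E => Dt_congr E.isOpen_dom (he E)

lemma T (i j : ℕ) (hij : i + j ≤ k) : IsJetPolynomial k (fun E => LinHyp.Dt^[i] (Dx^[j] E.T)) :=
  coeff 0 i j hij

lemma X (i j : ℕ) (hij : i + j ≤ k) : IsJetPolynomial k (fun E => LinHyp.Dt^[i] (Dx^[j] E.X)) :=
  coeff 1 i j hij

lemma U (i j : ℕ) (hij : i + j ≤ k) : IsJetPolynomial k (fun E => LinHyp.Dt^[i] (Dx^[j] E.U)) :=
  coeff 2 i j hij

lemma H : IsJetPolynomial 1 Equation.H :=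
  ((T 1 0 le_rfl).neg.add ((T 0 0 zero_le_one).mul (X 0 0 zero_le_one))).add (U 0 0 zero_le_one)

lemma K : IsJetPolynomial 1 Equation.K :=
  ((X 0 1 le_rfl).neg.add ((T 0 0 zero_le_one).mul (X 0 0 zero_le_one))).add (U 0 0 zero_le_one)

end IsJetPolynomial

/-! ### The invariant of a relative invariant and an absolute one -/

/-- The expression `(h_t f_t - h f_tt) h⁻¹ f_t⁻²`. If `f` is unchanged and `h` is multiplied by
the Jacobian under the changes `(t, x) ↦ (φ t, ψ x)`, then this expression is unchanged. -/
noncomputable def jExpr (h f : ℝ × ℝ → ℝ) (z : ℝ × ℝ) : ℝ :=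
  (Dt h z * Dt f z - h z * Dt (Dt f) z) * (h z)⁻¹ * (Dt f z ^ 2)⁻¹

lemma jExpr_comp {S : Set (ℝ × ℝ)} (hS : IsOpen S) {f f' h h' : ℝ × ℝ → ℝ}
    (hf' : ContDiffOn ℝ ∞ f' S) (hh' : ContDiffOn ℝ ∞ h' S) {A : Set ℝ} (hA : IsOpen A)
    {φ : ℝ → ℝ} (hφ : ContDiffOn ℝ ∞ φ A) {t x y c : ℝ} (hc : c ≠ 0)
    (hf : ∀ s ∈ A, f (s, x) = f' (φ s, y))
    (hh : ∀ s ∈ A, h (s, x) = deriv φ s * c * h' (φ s, y)) (ht : t ∈ A)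
    (hφt : deriv φ t ≠ 0) (htS : (φ t, y) ∈ S) :
    Dt f (t, x) = deriv φ t * Dt f' (φ t, y) ∧ jExpr h f (t, x) = jExpr h' f' (φ t, y) := by
  have hφd {s : ℝ} (hs : s ∈ A) : HasDerivAt φ (deriv φ s) s :=
    ((hφ.contDiffAt (hA.mem_nhds hs)).differentiableAt (by simp)).hasDerivAt
  have hφdd : HasDerivAt (deriv φ) (deriv (deriv φ) t) t :=
    (((hφ.deriv_of_isOpen (m := ∞) hA (by simp)).contDiffAt
      (hA.mem_nhds ht)).differentiableAt (by simp)).hasDerivAt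
  have hcomp {g : ℝ × ℝ → ℝ} (hg : ContDiffOn ℝ ∞ g S) {s : ℝ} (hs : s ∈ A)
      (hsS : (φ s, y) ∈ S) :
      HasDerivAt (fun s => g (φ s, y)) (Dt g (φ s, y) * deriv φ s) s :=
    HasDerivAt.comp (h₂ := fun r => g (r, y)) s
      (hasDerivAt_Dt (z := (φ s, y)) (differentiableAt_of_smooth hS hg hsS)) (hφd hs)
  have hev : ∀ᶠ s in 𝓝 t, s ∈ A ∧ (φ s, y) ∈ S :=
    (show ∀ᶠ s in 𝓝 t, s ∈ A from hA.mem_nhds ht).and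
      (((hφd ht).continuousAt.prodMk continuousAt_const).preimage_mem_nhds (hS.mem_nhds htS))
  have hDf : ∀ s, s ∈ A → (φ s, y) ∈ S → Dt f (s, x) = Dt f' (φ s, y) * deriv φ s :=
    fun s hs hsS => ((hcomp hf' hs hsS).congr_of_eventuallyEq
      (eventually_of_mem (hA.mem_nhds hs) hf)).deriv
  have hDDf : Dt (Dt f) (t, x) =
      Dt (Dt f') (φ t, y) * deriv φ t * deriv φ t + Dt f' (φ t, y) * deriv (deriv φ) t :=
    (((hcomp (smooth_Dt hS hf') ht htS).mul hφdd).congr_of_eventuallyEq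
      (hev.mono fun s hs => hDf s hs.1 hs.2)).deriv
  have hDh : Dt h (t, x) = deriv (deriv φ) t * c * h' (φ t, y) +
      deriv φ t * c * (Dt h' (φ t, y) * deriv φ t) :=
    (((hφdd.mul_const c).mul (hcomp hh' ht htS)).congr_of_eventuallyEq
      (eventually_of_mem (hA.mem_nhds ht) hh)).deriv
  refine ⟨(hDf t ht htS).trans (mul_comm _ _), ?_⟩
  simp only [jExpr]
  rw [hDf t ht htS, hDDf, hDh, hh t ht]
  -- numerator and denominator are both multiplied by `φ'³ c`; the denominators may vanish
  have e : (Dt h' (φ t, y) * Dt f' (φ t, y) - h' (φ t, y) * Dt (Dt f') (φ t, y)) *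
      (h' (φ t, y))⁻¹ * (Dt f' (φ t, y) ^ 2)⁻¹ =
      (Dt h' (φ t, y) * Dt f' (φ t, y) - h' (φ t, y) * Dt (Dt f') (φ t, y)) *
      (h' (φ t, y))⁻¹ * (Dt f' (φ t, y) ^ 2)⁻¹ * (deriv φ t ^ 3 * c * (deriv φ t ^ 3 * c)⁻¹) := by
    rw [mul_inv_cancel₀ (mul_ne_zero (pow_ne_zero 3 hφt) hc), mul_one]
  rw [e]
  simp only [mul_inv, mul_pow]
  ring

lemma Dt_div {S : Set (ℝ × ℝ)} (hS : IsOpen S) {n d : ℝ × ℝ → ℝ} (hn : ContDiffOn ℝ ∞ n S)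
    (hd : ContDiffOn ℝ ∞ d S) (hd0 : ∀ z ∈ S, d z ≠ 0) {z : ℝ × ℝ} (hz : z ∈ S) :
    Dt (fun z => n z / d z) z = (Dt n z * d z - n z * Dt d z) / d z ^ 2 :=
  ((hasDerivAt_Dt (differentiableAt_of_smooth hS hn hz)).div
    (hasDerivAt_Dt (differentiableAt_of_smooth hS hd hz)) (hd0 z hz)).deriv

/-- The expression `(h_t f_t - h f_tt) h⁻¹ f_t⁻²`, where `f` is a quotient of differential
polynomials, is a differential function. -/
lemma isDifferential_jExpr {k : ℕ} {h n d : Equation → ℝ × ℝ → ℝ} (hh : IsJetPolynomial k h)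
    (hn : IsJetPolynomial k n) (hd : IsJetPolynomial k d)
    (hhd : ∀ E z, h E z ≠ 0 → d E z ≠ 0) :
    DiffFn.IsDifferential
      { dom := fun E => {z | z ∈ E.dom ∧ h E z ≠ 0 ∧ Dt (fun z => n E z / d E z) z ≠ 0}
        val := fun E => jExpr (h E) (fun z => n E z / d E z) } := by
  let N : Equation → ℝ × ℝ → ℝ := fun E z => Dt (n E) z * d E z + -(n E z * Dt (d E) z)
  have hN : IsJetPolynomial (k + 1) N :=
    (hn.Dt.mul (hd.mono k.le_succ)).add ((hn.mono k.le_succ).mul hd.Dt).neg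
  have hd2 : IsJetPolynomial k (fun E z => d E z * d E z) := hd.mul hd
  obtain ⟨h₀, hh₀, eh₀⟩ := (hh.mono (by omega : k ≤ k + 2)).exists_contDiff
  obtain ⟨h₁, hh₁, eh₁⟩ := (hh.Dt.mono (by omega : k + 1 ≤ k + 2)).exists_contDiff
  obtain ⟨d₀, hd₀, ed₀⟩ := (hd2.mono (by omega : k ≤ k + 2)).exists_contDiff
  obtain ⟨d₁, hd₁, ed₁⟩ := (hd2.Dt.mono (by omega : k + 1 ≤ k + 2)).exists_contDiff
  obtain ⟨N₀, hN₀, eN₀⟩ := (hN.mono (by omega : k + 1 ≤ k + 2)).exists_contDiff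
  obtain ⟨N₁, hN₁, eN₁⟩ := hN.Dt.exists_contDiff
  -- `f_t = N / d²` and `f_tt = (N_t d² - N (d²)_t) / d⁴`
  have hS (E : Equation) : IsOpen {z | z ∈ E.dom ∧ h E z ≠ 0} :=
    (hh.smooth E).continuousOn.isOpen_inter_preimage E.isOpen_dom isOpen_ne
  have e1 (E : Equation) : EqOn (Dt (fun z => n E z / d E z))
      (fun z => N E z / (d E z * d E z)) {z | z ∈ E.dom ∧ h E z ≠ 0} := fun z hz => by
    rw [Dt_div (hS E) ((hn.smooth E).mono fun _ h => h.1) ((hd.smooth E).mono fun _ h => h.1)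
      (fun z hz => hhd E z hz.2) hz]
    simp only [N]
    ring
  have e2 (E : Equation) : EqOn (Dt (Dt (fun z => n E z / d E z)))
      (fun z => (Dt (N E) z * (d E z * d E z) - N E z * Dt (fun z => d E z * d E z) z) /
        (d E z * d E z) ^ 2) {z | z ∈ E.dom ∧ h E z ≠ 0} := fun z hz => by
    rw [Dt_congr (hS E) (e1 E) hz]
    exact Dt_div (hS E) ((hN.smooth E).mono fun _ h => h.1)
      ((hd2.smooth E).mono fun _ h => h.1)
      (fun z hz => mul_self_ne_zero.2 (hhd E z hz.2)) hz
  refine ⟨k + 2, {J | (h₀ J ≠ 0 ∧ d₀ J ≠ 0) ∧ N₀ J ≠ 0},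
    fun J => (h₁ J * (N₀ J / d₀ J) - h₀ J * ((N₁ J * d₀ J - N₀ J * d₁ J) / d₀ J ^ 2)) *
      (h₀ J)⁻¹ * ((N₀ J / d₀ J) ^ 2)⁻¹, ?_, ?_, fun E => ⟨?_, ?_⟩⟩
  · exact ((isOpen_ne.preimage hh₀.continuous).inter (isOpen_ne.preimage hd₀.continuous)).inter
      (isOpen_ne.preimage hN₀.continuous)
  · intro J hJ
    have hd0 : d₀ J ≠ 0 := hJ.1.2
    have hh0 : h₀ J ≠ 0 := hJ.1.1
    have hN0 : N₀ J ≠ 0 := hJ.2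
    have hq : ContDiffAt ℝ ∞ (fun J => N₀ J / d₀ J) J := hN₀.contDiffAt.div hd₀.contDiffAt hd0
    refine ContDiffAt.contDiffWithinAt ?_
    refine (((hh₁.contDiffAt.mul hq).sub (hh₀.contDiffAt.mul
      (((hN₁.contDiffAt.mul hd₀.contDiffAt).sub (hN₀.contDiffAt.mul hd₁.contDiffAt)).div
        (hd₀.contDiffAt.pow 2) (pow_ne_zero 2 hd0)))).mul (hh₀.contDiffAt.inv hh0)).mul
      ((hq.pow 2).inv (pow_ne_zero 2 (div_ne_zero hN0 hd0)))
  · ext z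
    simp only [mem_ofPred_eq]
    refine and_congr_right fun hz => ?_
    rw [← eh₀ E z hz, ← ed₀ E z hz, ← eN₀ E z hz]
    constructor
    · rintro ⟨h1, h2⟩
      rw [e1 E ⟨hz, h1⟩] at h2
      exact ⟨⟨h1, mul_self_ne_zero.2 (hhd E z h1)⟩, fun h0 => h2 (by simp [h0])⟩
    · rintro ⟨⟨h1, h2⟩, h3⟩
      refine ⟨h1, ?_⟩
      rw [e1 E ⟨hz, h1⟩]
      exact div_ne_zero h3 h2
  · rintro z ⟨hz, hz0, -⟩
    simp only [jExpr]
    rw [e1 E ⟨hz, hz0⟩, e2 E ⟨hz, hz0⟩]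
    beta_reduce
    rw [eh₀ E z hz, eh₁ E z hz, eN₀ E z hz, ed₀ E z hz,
      eN₁ E z hz, ed₁ E z hz]

/-! ### The invariant `J` -/

/-- Near a point where `H P_t ≠ 0`, a contact equivalence is a change `(t, x) ↦ (φ t, ψ x)` that
multiplies `H` and `K` by the Jacobian, so that `P = K / H` is an absolute invariant. -/
theorem isDifferentialInvariant_invJ : IsDifferentialInvariant univ invJ := by
  refine ⟨isDifferential_jExpr IsJetPolynomial.H IsJetPolynomial.K IsJetPolynomial.H
    fun _ _ h => h, ?_⟩
  rintro E - E' - W Ψ h w hw ⟨hwE, hH, hP⟩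
  -- `K` vanishes on no open set where `P_t ≠ 0`
  have hK : ∀ᶠ z in 𝓝 (base w), ∃ᶠ y in 𝓝 z, E.K y ≠ 0 := by
    have hPev : ∀ᶠ z in 𝓝 (base w), Dt E.P z ≠ 0 :=
      ((smooth_Dt E.isOpen_H_ne E.smooth_P).continuousOn.continuousAt
        (E.isOpen_H_ne.mem_nhds ⟨hwE, hH⟩)).eventually_ne hP
    filter_upwards [hPev] with z hz hfr
    simp only [not_not] at hfr
    refine hz ?_
    have : ∀ᶠ s in 𝓝 z.1, E.P (s, z.2) = 0 := by
      filter_upwards [(Continuous.prodMk_left z.2).continuousAt.eventually hfr] with s hs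
      simp [Equation.P, hs]
    exact (EventuallyEq.deriv_eq this).trans (deriv_const _ _)
  obtain ⟨A, B, φ, ψ, hb, hA, hB, hbase⟩ := h.exists_isBaseChange hw hH hK
  have hjac := mul_ne_zero (hb.deriv_φ_ne _ hA) (hb.deriv_ψ_ne _ hB)
  have hH' : E'.H (φ (w 0), ψ (w 1)) ≠ 0 := fun h0 => hH (by
    rw [base, hb.H_eq _ hA _ hB, h0, mul_zero])
  have hPP : ∀ s ∈ A, E.P (s, w 1) = E'.P (φ s, ψ (w 1)) := fun s hs => by
    rw [Equation.P, hb.H_eq s hs _ hB, hb.K_eq s hs _ hB,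
      mul_div_mul_left _ _ (mul_ne_zero (hb.deriv_φ_ne _ hs) (hb.deriv_ψ_ne _ hB)), Equation.P]
  obtain ⟨h1, h2⟩ := jExpr_comp E'.isOpen_H_ne E'.smooth_P (E'.smooth_H.mono fun _ h => h.1)
    hb.isOpen_A hb.smooth_φ (hb.deriv_ψ_ne _ hB) hPP (fun s hs => hb.H_eq s hs _ hB) hA
    (hb.deriv_φ_ne _ hA) ⟨hb.target _ hA _ hB, hH'⟩
  rw [hbase]
  refine ⟨⟨hb.target _ hA _ hB, hH', fun h0 => hP ?_⟩, h2.symm⟩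
  rw [base, h1, h0, mul_zero]

/-! ### An invariant of Moutard equations -/

/-- The invariant `(ln |U|)_tx / U` of a Moutard equation, with the logarithm expanded. -/
noncomputable def moutardQ (E : Equation) (z : ℝ × ℝ) : ℝ :=
  (E.U z * Dt (Dx E.U) z + -(Dt E.U z * Dx E.U z)) / (E.U z * E.U z * E.U z)

/-- The analogue of `J` for Moutard equations, with `(ln |U|)_tx / U` in place of `P`, which is
constant on this class. -/
noncomputable def invMoutard : DiffFn where
  dom E := {z | z ∈ E.dom ∧ E.U z ≠ 0 ∧ Dt (moutardQ E) z ≠ 0}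
  val E := jExpr E.U (moutardQ E)

lemma H_eq_U {E : Equation} (hE : E ∈ moutardClass) {z : ℝ × ℝ} (hz : z ∈ E.dom) :
    E.H z = E.U z := by
  have hT : EqOn E.T (fun _ => 0) E.dom := fun z hz => (hE z hz).1
  have h0 : Dt E.T z = 0 := (Dt_congr E.isOpen_dom hT hz).trans (deriv_const _ _)
  simp [Equation.H, h0, (hE z hz).1]

lemma K_eq_U {E : Equation} (hE : E ∈ moutardClass) {z : ℝ × ℝ} (hz : z ∈ E.dom) :
    E.K z = E.U z := by
  have hX : EqOn E.X (fun _ => 0) E.dom := fun z hz => (hE z hz).2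
  have h0 : Dx E.X z = 0 := (Dx_congr E.isOpen_dom hX hz).trans (deriv_const _ _)
  simp [Equation.K, h0, (hE z hz).1]

lemma isOpen_U_ne (E : Equation) : IsOpen {z | z ∈ E.dom ∧ E.U z ≠ 0} :=
  E.smooth_U.continuousOn.isOpen_inter_preimage E.isOpen_dom isOpen_ne

lemma smooth_moutardQ (E : Equation) :
    ContDiffOn ℝ ∞ (moutardQ E) {z | z ∈ E.dom ∧ E.U z ≠ 0} := by
  have hU := E.smooth_U
  have hUx := smooth_Dx E.isOpen_dom hU
  refine ContDiffOn.div (((hU.mul (smooth_Dt E.isOpen_dom hUx)).add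
    ((smooth_Dt E.isOpen_dom hU).mul hUx).neg).mono fun _ h => h.1)
    (((hU.mul hU).mul hU).mono fun _ h => h.1)
    fun z hz => mul_ne_zero (mul_ne_zero hz.2 hz.2) hz.2

/-- If `U = φ' ψ' U'(φ, ψ)`, then the second derivatives of `φ` and `ψ` cancel in
`U U_tx - U_t U_x`, which is multiplied by `(φ' ψ')³`, as is `U³`. -/
lemma moutardQ_baseChange {E E' : Equation} (hE : E ∈ moutardClass) (hE' : E' ∈ moutardClass)
    {A B : Set ℝ} {φ ψ : ℝ → ℝ} (hb : IsBaseChange E E' A B φ ψ) {t x : ℝ} (ht : t ∈ A)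
    (hx : x ∈ B) : moutardQ E (t, x) = moutardQ E' (φ t, ψ x) := by
  have hU : ∀ t ∈ A, ∀ x ∈ B, E.U (t, x) = deriv φ t * deriv ψ x * E'.U (φ t, ψ x) :=
    fun t ht x hx => by
      rw [← H_eq_U hE (hb.source t ht x hx), hb.H_eq t ht x hx,
        H_eq_U hE' (hb.target t ht x hx)]
  have hφ {s : ℝ} (hs : s ∈ A) : HasDerivAt φ (deriv φ s) s :=
    ((hb.smooth_φ.contDiffAt (hb.isOpen_A.mem_nhds hs)).differentiableAt (by simp)).hasDerivAt
  have hψ {y : ℝ} (hy : y ∈ B) : HasDerivAt ψ (deriv ψ y) y :=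
    ((hb.smooth_ψ.contDiffAt (hb.isOpen_B.mem_nhds hy)).differentiableAt (by simp)).hasDerivAt
  have hφ' {s : ℝ} (hs : s ∈ A) : HasDerivAt (deriv φ) (deriv (deriv φ) s) s :=
    (((hb.smooth_φ.deriv_of_isOpen (m := ∞) hb.isOpen_A (by simp)).contDiffAt
      (hb.isOpen_A.mem_nhds hs)).differentiableAt (by simp)).hasDerivAt
  have hψ' {y : ℝ} (hy : y ∈ B) : HasDerivAt (deriv ψ) (deriv (deriv ψ) y) y :=
    (((hb.smooth_ψ.deriv_of_isOpen (m := ∞) hb.isOpen_B (by simp)).contDiffAt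
      (hb.isOpen_B.mem_nhds hy)).differentiableAt (by simp)).hasDerivAt
  have hct {g : ℝ × ℝ → ℝ} (hg : ContDiffOn ℝ ∞ g E'.dom) {s y : ℝ} (hs : s ∈ A) (hy : y ∈ B) :
      HasDerivAt (fun s => g (φ s, ψ y)) (Dt g (φ s, ψ y) * deriv φ s) s :=
    HasDerivAt.comp (h₂ := fun r => g (r, ψ y)) s (hasDerivAt_Dt (z := (φ s, ψ y))
      (differentiableAt_of_smooth E'.isOpen_dom hg (hb.target s hs y hy))) (hφ hs)
  have hcx {g : ℝ × ℝ → ℝ} (hg : ContDiffOn ℝ ∞ g E'.dom) {s y : ℝ} (hs : s ∈ A) (hy : y ∈ B) :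
      HasDerivAt (fun y => g (φ s, ψ y)) (Dx g (φ s, ψ y) * deriv ψ y) y :=
    HasDerivAt.comp (h₂ := fun r => g (φ s, r)) y (hasDerivAt_Dx (z := (φ s, ψ y))
      (differentiableAt_of_smooth E'.isOpen_dom hg (hb.target s hs y hy))) (hψ hy)
  have hUt : Dt E.U (t, x) = deriv ψ x * (deriv (deriv φ) t * E'.U (φ t, ψ x) +
      deriv φ t ^ 2 * Dt E'.U (φ t, ψ x)) := by
    have := ((((hφ' ht).mul_const (deriv ψ x)).mul (hct E'.smooth_U ht hx)).congr_of_eventuallyEq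
      (eventually_of_mem (hb.isOpen_A.mem_nhds ht) fun s hs => hU s hs x hx)).deriv
    exact this.trans (by ring)
  have hUx : ∀ s ∈ A, Dx E.U (s, x) = deriv φ s * (deriv (deriv ψ) x * E'.U (φ s, ψ x) +
      deriv ψ x ^ 2 * Dx E'.U (φ s, ψ x)) := fun s hs => by
    have := ((((hψ' hx).const_mul (deriv φ s)).mul (hcx E'.smooth_U hs hx)).congr_of_eventuallyEq
      (eventually_of_mem (hb.isOpen_B.mem_nhds hx) fun y hy => hU s hs y hy)).deriv
    exact this.trans (by ring)
  have hUtx : Dt (Dx E.U) (t, x) =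
      deriv (deriv φ) t * (deriv (deriv ψ) x * E'.U (φ t, ψ x) +
        deriv ψ x ^ 2 * Dx E'.U (φ t, ψ x)) +
      deriv φ t ^ 2 * (deriv (deriv ψ) x * Dt E'.U (φ t, ψ x) +
        deriv ψ x ^ 2 * Dt (Dx E'.U) (φ t, ψ x)) := by
    have := (((hφ' ht).mul (((hct E'.smooth_U ht hx).const_mul (deriv (deriv ψ) x)).add
      ((hct (smooth_Dx E'.isOpen_dom E'.smooth_U) ht hx).const_mul
        (deriv ψ x ^ 2)))).congr_of_eventuallyEq
      (eventually_of_mem (hb.isOpen_A.mem_nhds ht) fun s hs => hUx s hs)).deriv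
    exact this.trans (by simp only [Pi.add_apply]; ring)
  rw [moutardQ, hUtx, hUt, hUx t ht, hU t ht x hx, moutardQ]
  symm
  rw [← mul_div_mul_left _ _ (pow_ne_zero 3 (mul_ne_zero (hb.deriv_φ_ne t ht)
      (hb.deriv_ψ_ne x hx)))]
  congr 1 <;> ring

theorem isDifferentialInvariant_invMoutard : IsDifferentialInvariant moutardClass invMoutard := by
  have hU : IsJetPolynomial 2 Equation.U := IsJetPolynomial.U 0 0 (by norm_num)
  have hUt : IsJetPolynomial 2 (fun E => Dt E.U) := IsJetPolynomial.U 1 0 (by norm_num)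
  have hUx : IsJetPolynomial 2 (fun E => Dx E.U) := IsJetPolynomial.U 0 1 (by norm_num)
  have hUtx : IsJetPolynomial 2 (fun E => Dt (Dx E.U)) := IsJetPolynomial.U 1 1 (by norm_num)
  refine ⟨isDifferential_jExpr hU ((hU.mul hUtx).add (hUt.mul hUx).neg) ((hU.mul hU).mul hU)
    fun _ _ h => mul_ne_zero (mul_ne_zero h h) h, ?_⟩
  rintro E hE E' hE' W Ψ h w hw ⟨hwE, hU0, hQ⟩
  have hK : ∀ᶠ z in 𝓝 (base w), ∃ᶠ y in 𝓝 z, E.K y ≠ 0 := by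
    filter_upwards [(isOpen_U_ne E).mem_nhds ⟨hwE, hU0⟩] with z hz
    refine Eventually.frequently ?_
    filter_upwards [(isOpen_U_ne E).mem_nhds hz] with y hy
    rw [K_eq_U hE hy.1]
    exact hy.2
  obtain ⟨A, B, φ, ψ, hb, hA, hB, hbase⟩ := h.exists_isBaseChange hw
    (by rwa [H_eq_U hE hwE]) hK
  have hUU : ∀ s ∈ A, E.U (s, w 1) = deriv φ s * deriv ψ (w 1) * E'.U (φ s, ψ (w 1)) :=
    fun s hs => by
      rw [← H_eq_U hE (hb.source s hs _ hB), hb.H_eq s hs _ hB,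
        H_eq_U hE' (hb.target s hs _ hB)]
  have hU' : E'.U (φ (w 0), ψ (w 1)) ≠ 0 := fun h0 => hU0 (by
    rw [base, hUU _ hA, h0, mul_zero])
  obtain ⟨h1, h2⟩ := jExpr_comp (isOpen_U_ne E') (smooth_moutardQ E')
    (E'.smooth_U.mono fun _ h => h.1) hb.isOpen_A hb.smooth_φ (hb.deriv_ψ_ne _ hB)
    (fun s hs => moutardQ_baseChange hE hE' hb hs hB) hUU hA
    (hb.deriv_φ_ne _ hA) ⟨hb.target _ hA _ hB, hU'⟩
  rw [hbase]
  refine ⟨⟨hb.target _ hA _ hB, hU', fun h0 => hQ ?_⟩, h2.symm⟩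
  rw [base, h1, h0, mul_zero]

/-! ### Functions of `t` alone -/

/-- On `V`, the function `g` depends on `t` only. -/
def IndependentOfX (g : ℝ × ℝ → ℝ) (V : Set (ℝ × ℝ)) : Prop :=
  ∀ t x y, (t, x) ∈ V → (t, y) ∈ V → g (t, x) = g (t, y)

lemma IndependentOfX.mono {g : ℝ × ℝ → ℝ} {V W : Set (ℝ × ℝ)} (h : IndependentOfX g W)
    (hVW : V ⊆ W) : IndependentOfX g V := fun t x y hx hy => h t x y (hVW hx) (hVW hy)

lemma independentOfX_of_eq {g : ℝ × ℝ → ℝ} {V : Set (ℝ × ℝ)} (c : ℝ → ℝ)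
    (h : ∀ z ∈ V, g z = c z.1) : IndependentOfX g V := fun _ _ _ hx hy => by rw [h _ hx, h _ hy]

lemma IndependentOfX.Dx_eq_zero {g : ℝ × ℝ → ℝ} {V : Set (ℝ × ℝ)} (h : IndependentOfX g V)
    (hV : IsOpen V) {z : ℝ × ℝ} (hz : z ∈ V) : Dx g z = 0 := by
  have : (fun y => g (z.1, y)) =ᶠ[𝓝 z.2] fun _ => g z :=
    (eventually_snd_mem hV hz).mono fun y hy => h _ _ _ hy hz
  exact this.deriv_eq.trans (deriv_const _ _)

lemma IndependentOfX.Dt {g : ℝ × ℝ → ℝ} {A B : Set ℝ} (hA : IsOpen A)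
    (h : IndependentOfX g (A ×ˢ B)) : IndependentOfX (Dt g) (A ×ˢ B) := by
  rintro t x y ⟨ht, hx⟩ ⟨-, hy⟩
  exact EventuallyEq.deriv_eq (eventually_of_mem (hA.mem_nhds ht) fun s hs =>
    h s x y ⟨hs, hx⟩ ⟨hs, hy⟩)

/-- If the given functions and the `D_t`-coefficients of the given operators depend on `t` only,
then so do all generated functions, on rectangles. -/
lemma Generated.independentOfX {S : Set DiffFn} {𝒟 : Set DiffOp} {E : Equation}
    (hS : ∀ G ∈ S, IndependentOfX (G.val E) (G.dom E))
    (h𝒟 : ∀ D ∈ 𝒟, IndependentOfX (D.coefT.val E) (D.coefT.dom E)) {A B : Set ℝ}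
    (hA : IsOpen A) (hB : IsOpen B) {G : DiffFn} (hG : Generated S 𝒟 G)
    (hdom : A ×ˢ B ⊆ G.dom E) : IndependentOfX (G.val E) (A ×ˢ B) := by
  induction hG with
  | basic h => exact (hS _ h).mono hdom
  | @derivative D G hD _ ih =>
    have hi := ih fun z hz => interior_subset (hdom hz).2
    intro t x y hx hy
    have h1 := (h𝒟 D hD).mono (fun z hz => (hdom hz).1.1) t x y hx hy
    have h2 := hi.Dt hA t x y hx hy
    simp only [DiffOp.apply]
    rw [h1, h2, hi.Dx_eq_zero (hA.prod hB) hx, hi.Dx_eq_zero (hA.prod hB) hy]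
    simp

/-- A function with nonzero `x`-derivative is no function of generated ones when these all depend
on `t` only. -/
lemma not_isFunctionOfGenerated {S : Set DiffFn} {𝒟 : Set DiffOp} {E : Equation}
    (hS : ∀ G ∈ S, IndependentOfX (G.val E) (G.dom E))
    (h𝒟 : ∀ D ∈ 𝒟, IndependentOfX (D.coefT.val E) (D.coefT.dom E)) {F : DiffFn}
    {V : Set (ℝ × ℝ)} (hV : IsOpen V) (hne : V.Nonempty) (hF : ∀ z ∈ V, Dx (F.val E) z ≠ 0) :
    ¬ IsFunctionOfGenerated S 𝒟 F E V := by
  rintro ⟨n, G, Φ, hG, hΦ⟩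
  obtain ⟨⟨t, x⟩, hz⟩ := hne
  obtain ⟨A, B, hA, hB, ht, hx, hAB⟩ := isOpen_prod_iff.1 hV t x hz
  have hi : IndependentOfX (F.val E) (A ×ˢ B) := fun s y y' hy hy' => by
    rw [hΦ _ (hAB hy), hΦ _ (hAB hy')]
    congr 1
    funext i
    exact (hG i).1.independentOfX hS h𝒟 hA hB (hAB.trans (hG i).2) s y y' hy hy'
  exact hF _ hz (hi.Dx_eq_zero (hA.prod hB) ⟨ht, hx⟩)

/-! ### The function `2 / (q(t) (t + x)²)` -/

/-- On the open set `V`, the function `h` is `2 / (q(t) (t + x)²)`, with `q` smooth and without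
zeros. Such functions are the solutions of `(ln |h|)_tx = q(t) h` that arise here. -/
structure IsProfile (V : Set (ℝ × ℝ)) (A : Set ℝ) (q : ℝ → ℝ) (h : ℝ × ℝ → ℝ) : Prop where
  isOpen_V : IsOpen V
  isOpen_A : IsOpen A
  smooth : ContDiffOn ℝ ∞ q A
  ne_zero : ∀ t ∈ A, q t ≠ 0
  mem : ∀ z ∈ V, z.1 ∈ A ∧ z.1 + z.2 ≠ 0
  eq : ∀ z ∈ V, h z = 2 / (q z.1 * (z.1 + z.2) ^ 2)

lemma hasDerivAt_of_smooth {A : Set ℝ} (hA : IsOpen A) {q : ℝ → ℝ} (hq : ContDiffOn ℝ ∞ q A)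
    {t : ℝ} (ht : t ∈ A) : HasDerivAt q (deriv q t) t :=
  ((hq.contDiffAt (hA.mem_nhds ht)).differentiableAt (by simp)).hasDerivAt

namespace IsProfile

variable {V : Set (ℝ × ℝ)} {A : Set ℝ} {p q : ℝ → ℝ} {h : ℝ × ℝ → ℝ} {z : ℝ × ℝ}

lemma apply_ne_zero (H : IsProfile V A q h) (hz : z ∈ V) : h z ≠ 0 := by
  rw [H.eq z hz]
  have := H.ne_zero _ (H.mem z hz).1
  have := (H.mem z hz).2
  positivity

lemma hasDerivAt_fst (H : IsProfile V A q h) (hz : z ∈ V) :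
    HasDerivAt (fun t => h (t, z.2))
      (-h z * (deriv q z.1 / q z.1 + 2 / (z.1 + z.2))) z.1 := by
  have hq0 := H.ne_zero _ (H.mem z hz).1
  have hs0 := (H.mem z hz).2
  have hs : HasDerivAt (fun t => t + z.2) 1 z.1 := (hasDerivAt_id z.1).add_const z.2
  have := (hasDerivAt_const z.1 (2 : ℝ)).div
    ((hasDerivAt_of_smooth H.isOpen_A H.smooth (H.mem z hz).1).mul (hs.pow 2))
    (mul_ne_zero hq0 (pow_ne_zero 2 hs0))
  refine (this.congr_of_eventuallyEq ((eventually_fst_mem H.isOpen_V hz).mono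
    fun t ht => H.eq _ ht)).congr_deriv ?_
  rw [H.eq z hz]
  simp only [Pi.mul_apply, Pi.pow_apply]
  field_simp
  ring

lemma hasDerivAt_snd (H : IsProfile V A q h) (hz : z ∈ V) :
    HasDerivAt (fun x => h (z.1, x)) (-h z * (2 / (z.1 + z.2))) z.2 := by
  have hq0 := H.ne_zero _ (H.mem z hz).1
  have hs0 := (H.mem z hz).2
  have hs : HasDerivAt (fun x => z.1 + x) 1 z.2 := (hasDerivAt_id z.2).const_add z.1
  have := (hasDerivAt_const z.2 (2 : ℝ)).div ((hs.pow 2).const_mul (q z.1))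
    (mul_ne_zero hq0 (pow_ne_zero 2 hs0))
  refine (this.congr_of_eventuallyEq ((eventually_snd_mem H.isOpen_V hz).mono
    fun t ht => H.eq _ ht)).congr_deriv ?_
  rw [H.eq z hz]
  simp only [Pi.pow_apply]
  field_simp
  ring

lemma Dt_eq (H : IsProfile V A q h) (hz : z ∈ V) :
    Dt h z = -h z * (deriv q z.1 / q z.1 + 2 / (z.1 + z.2)) := (H.hasDerivAt_fst hz).deriv

lemma Dx_eq (H : IsProfile V A q h) (hz : z ∈ V) : Dx h z = -h z * (2 / (z.1 + z.2)) :=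
  (H.hasDerivAt_snd hz).deriv

lemma hasDerivAt_two_div_snd (H : IsProfile V A q h) (hz : z ∈ V) :
    HasDerivAt (fun x => 2 / (z.1 + x)) (-2 / (z.1 + z.2) ^ 2) z.2 := by
  have hs : HasDerivAt (fun x => z.1 + x) 1 z.2 := (hasDerivAt_id z.2).const_add z.1
  exact ((hasDerivAt_const z.2 (2 : ℝ)).div hs (H.mem z hz).2).congr_deriv (by ring)

lemma hasDerivAt_two_div_fst (H : IsProfile V A q h) (hz : z ∈ V) :
    HasDerivAt (fun t => 2 / (t + z.2)) (-2 / (z.1 + z.2) ^ 2) z.1 := by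
  have hs : HasDerivAt (fun t => t + z.2) 1 z.1 := (hasDerivAt_id z.1).add_const z.2
  exact ((hasDerivAt_const z.1 (2 : ℝ)).div hs (H.mem z hz).2).congr_deriv (by ring)

lemma Dx_Dt_eq (H : IsProfile V A q h) (hz : z ∈ V) :
    Dx (Dt h) z = h z * ((deriv q z.1 / q z.1 + 2 / (z.1 + z.2)) * (2 / (z.1 + z.2))
      + 2 / (z.1 + z.2) ^ 2) := by
  rw [Dx_eq_of_hasDerivAt H.isOpen_V (fun z hz => H.Dt_eq hz) hz
    ((H.hasDerivAt_snd hz).neg.mul ((H.hasDerivAt_two_div_snd hz).const_add (deriv q z.1 / q z.1)))]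
  simp only [Pi.neg_apply]
  ring

lemma Dt_Dx_eq (H : IsProfile V A q h) (hz : z ∈ V) :
    Dt (Dx h) z = h z * ((deriv q z.1 / q z.1 + 2 / (z.1 + z.2)) * (2 / (z.1 + z.2))
      + 2 / (z.1 + z.2) ^ 2) := by
  rw [Dt_eq_of_hasDerivAt H.isOpen_V (fun z hz => H.Dx_eq hz) hz
    ((H.hasDerivAt_fst hz).neg.mul (H.hasDerivAt_two_div_fst hz))]
  simp only [Pi.neg_apply]
  ring

lemma Dx_Dx_eq (H : IsProfile V A q h) (hz : z ∈ V) :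
    Dx (Dx h) z = h z * (6 / (z.1 + z.2) ^ 2) := by
  rw [Dx_eq_of_hasDerivAt H.isOpen_V (fun z hz => H.Dx_eq hz) hz
    ((H.hasDerivAt_snd hz).neg.mul (H.hasDerivAt_two_div_snd hz))]
  simp only [Pi.neg_apply]
  have hs0 := (H.mem z hz).2
  field_simp
  ring

/-- The equation `(ln |h|)_tx / h = q`. -/
lemma log_eq (H : IsProfile V A q h) (hz : z ∈ V) :
    Dx (Dt (fun w => Real.log |h w|)) z / h z = q z.1 := by
  have h1 : EqOn (Dt (fun w => Real.log |h w|))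
      (fun z => -(deriv q z.1 / q z.1 + 2 / (z.1 + z.2))) V := fun z hz => by
    have h0 := H.apply_ne_zero hz
    simp only [Real.log_abs]
    refine ((H.hasDerivAt_fst hz).log h0).deriv.trans ?_
    field_simp
  have hq0 := H.ne_zero _ (H.mem z hz).1
  have hs0 := (H.mem z hz).2
  rw [Dx_eq_of_hasDerivAt H.isOpen_V h1 hz
    ((H.hasDerivAt_two_div_snd hz).const_add (deriv q z.1 / q z.1)).fun_neg,
    H.eq z hz]
  field_simp

/-- For a function `p(t)` the invariant `J` formed with `h` depends on `x`. -/
lemma jExpr_eq (H : IsProfile V A q h) {f : ℝ × ℝ → ℝ}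
    (hf : ∀ z ∈ V, f z = p z.1) (hz : z ∈ V) (hp' : deriv p z.1 ≠ 0) :
    Dt f z = deriv p z.1 ∧ jExpr h f z =
      -2 / (deriv p z.1 * (z.1 + z.2)) - deriv (deriv p) z.1 / deriv p z.1 ^ 2
        - deriv q z.1 / (deriv p z.1 * q z.1) := by
  have h1 : EqOn (Dt f) (fun z => deriv p z.1) V := fun z hz =>
    Dt_congr H.isOpen_V hf hz
  have h2 : Dt (Dt f) z = deriv (deriv p) z.1 := Dt_congr H.isOpen_V h1 hz
  refine ⟨h1 hz, ?_⟩
  have hq0 := H.ne_zero _ (H.mem z hz).1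
  have hs0 := (H.mem z hz).2
  have hh0 := H.apply_ne_zero hz
  rw [jExpr, h2, h1 hz, H.Dt_eq hz]
  field_simp
  ring

lemma Dx_jExpr_ne_zero (H : IsProfile V A q h) {f : ℝ × ℝ → ℝ}
    (hf : ∀ z ∈ V, f z = p z.1) (hz : z ∈ V) (hp' : ∀ t ∈ A, deriv p t ≠ 0) :
    Dx (jExpr h f) z ≠ 0 := by
  have hp0 := hp' _ (H.mem z hz).1
  have hs0 := (H.mem z hz).2
  have h1 : EqOn (jExpr h f) (fun z => -(deriv p z.1)⁻¹ * (2 / (z.1 + z.2)) -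
      (deriv (deriv p) z.1 / deriv p z.1 ^ 2 + deriv q z.1 / (deriv p z.1 * q z.1))) V :=
    fun z hz => by
      rw [(H.jExpr_eq hf hz (hp' _ (H.mem z hz).1)).2]
      simp only [div_eq_mul_inv, mul_inv]
      ring
  rw [Dx_eq_of_hasDerivAt H.isOpen_V h1 hz
    (((H.hasDerivAt_two_div_snd hz).const_mul (-(deriv p z.1)⁻¹)).sub_const
      (deriv (deriv p) z.1 / deriv p z.1 ^ 2 + deriv q z.1 / (deriv p z.1 * q z.1)))]
  exact mul_ne_zero (neg_ne_zero.2 (inv_ne_zero hp0))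
    (div_ne_zero (by norm_num) (pow_ne_zero 2 hs0))

end IsProfile

/-! ### The explicit equation -/

namespace IsCounterexample

variable {A : Set ℝ} {p q : ℝ → ℝ} {E : Equation} {z : ℝ × ℝ}

lemma H_isProfile (h : IsCounterexample A p q E) : IsProfile E.dom A q E.H := by
  refine ⟨E.isOpen_dom, h.isOpen, h.smooth_q, h.q_ne, h.dom, fun z hz => ?_⟩
  have hT : Dt E.T z = 0 :=
    Dt_eq_of_hasDerivAt E.isOpen_dom (g := fun _ => 1) h.T_eq hz (hasDerivAt_const _ _)
  have hq0 := h.q_ne _ (h.dom z hz).1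
  have hs0 := (h.dom z hz).2
  rw [Equation.H, hT, h.T_eq z hz, h.X_eq z hz, h.U_eq z hz]
  field_simp
  ring

/-- `K = p H` is of the same form as `H`, with `q / p` in place of `q`. -/
lemma K_isProfile (h : IsCounterexample A p q E) :
    IsProfile E.dom A (fun t => q t / p t) E.K := by
  refine ⟨E.isOpen_dom, h.isOpen, h.smooth_q.div h.smooth_p h.p_ne,
    fun t ht => div_ne_zero (h.q_ne t ht) (h.p_ne t ht), h.dom, fun z hz => ?_⟩
  have hq0 := h.q_ne _ (h.dom z hz).1
  have hp0 := h.p_ne _ (h.dom z hz).1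
  have hs0 := (h.dom z hz).2
  have hs : HasDerivAt (fun x => z.1 + x) 1 z.2 := (hasDerivAt_id z.2).const_add z.1
  have hX := Dx_eq_of_hasDerivAt E.isOpen_dom
    (g := fun z => 2 * (p z.1 - 1) / (q z.1 * (z.1 + z.2))) h.X_eq hz
    ((hasDerivAt_const z.2 (2 * (p z.1 - 1))).div (hs.const_mul (q z.1)) (mul_ne_zero hq0 hs0))
  rw [Equation.K, hX, h.T_eq z hz, h.X_eq z hz, h.U_eq z hz]
  field_simp
  ring

lemma K_eq (h : IsCounterexample A p q E) (hz : z ∈ E.dom) : E.K z = p z.1 * E.H z := by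
  have hp0 := h.p_ne _ (h.dom z hz).1
  have hq0 := h.q_ne _ (h.dom z hz).1
  have hs0 := (h.dom z hz).2
  rw [h.K_isProfile.eq z hz, h.H_isProfile.eq z hz]
  field_simp

lemma P_eq (h : IsCounterexample A p q E) (hz : z ∈ E.dom) : E.P z = p z.1 := by
  rw [Equation.P, h.K_eq hz, mul_div_cancel_right₀ _ (h.H_isProfile.apply_ne_zero hz)]

lemma Q_eq (h : IsCounterexample A p q E) (hz : z ∈ E.dom) : E.Q z = q z.1 :=
  h.H_isProfile.log_eq hz

lemma Dx_P_eq (h : IsCounterexample A p q E) (hz : z ∈ E.dom) : Dx E.P z = 0 :=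
  (independentOfX_of_eq p fun _ hz => h.P_eq hz).Dx_eq_zero E.isOpen_dom hz

lemma Dx_Q_eq (h : IsCounterexample A p q E) (hz : z ∈ E.dom) : Dx E.Q z = 0 :=
  (independentOfX_of_eq q fun _ hz => h.Q_eq hz).Dx_eq_zero E.isOpen_dom hz

lemma Dt_P_eq (h : IsCounterexample A p q E) (hz : z ∈ E.dom) : Dt E.P z = deriv p z.1 :=
  Dt_congr E.isOpen_dom (fun _ hz => h.P_eq hz) hz

lemma Dt_Q_eq (h : IsCounterexample A p q E) (hz : z ∈ E.dom) : Dt E.Q z = deriv q z.1 :=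
  Dt_congr E.isOpen_dom (fun _ hz => h.Q_eq hz) hz

lemma invQtilde_eq (h : IsCounterexample A p q E) (hz : z ∈ E.dom) :
    invQtilde.val E z = q z.1 / p z.1 := h.K_isProfile.log_eq hz

lemma invI_eq (h : IsCounterexample A p q E) (hz : z ∈ E.dom) : invI.val E z = 0 := by
  simp [invI, h.Dx_P_eq hz]

lemma deriv_q_div_p (h : IsCounterexample A p q E) {t : ℝ} (ht : t ∈ A) :
    deriv (fun t => q t / p t) t / (q t / p t) = deriv q t / q t - deriv p t / p t := by
  have hp0 := h.p_ne t ht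
  have hq0 := h.q_ne t ht
  rw [((hasDerivAt_of_smooth h.isOpen h.smooth_q ht).fun_div
    (hasDerivAt_of_smooth h.isOpen h.smooth_p ht) hp0).deriv]
  field_simp

lemma invJ13_eq (h : IsCounterexample A p q E) (hz : z ∈ E.dom) :
    invJ13.val E z = 2 * p z.1 * q z.1 := by
  have hH := h.H_isProfile
  have hK := h.K_isProfile
  have hp0 := h.p_ne _ (h.dom z hz).1
  have hq0 := h.q_ne _ (h.dom z hz).1
  have hs0 := (h.dom z hz).2
  simp only [invJ13]
  rw [hH.Dt_eq hz, hH.Dx_eq hz, hK.Dt_eq hz, hK.Dx_eq hz, hH.Dx_Dt_eq hz, hK.Dx_Dt_eq hz,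
    h.deriv_q_div_p (h.dom z hz).1, h.K_eq hz, hH.eq z hz]
  field_simp
  ring

lemma invJ23_eq (h : IsCounterexample A p q E) (hz : z ∈ E.dom) : invJ23.val E z = 0 := by
  have : E.H z * Dx E.K z - E.K z * Dx E.H z = 0 := by
    rw [h.H_isProfile.Dx_eq hz, h.K_isProfile.Dx_eq hz]
    ring
  simp only [invJ23]
  rw [this]
  ring

lemma invJ33_eq (h : IsCounterexample A p q E) (hz : z ∈ E.dom) : invJ33.val E z = 0 := by
  have : E.H z * E.K z * Dx (Dx E.H) z - E.H z ^ 2 * Dx (Dx E.K) z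
      - 3 * E.K z * Dx E.H z ^ 2 + 3 * E.H z * Dx E.H z * Dx E.K z = 0 := by
    rw [h.H_isProfile.Dx_eq hz, h.K_isProfile.Dx_eq hz, h.H_isProfile.Dx_Dx_eq hz,
      h.K_isProfile.Dx_Dx_eq hz]
    ring
  simp only [invJ33]
  rw [this, mul_zero]

theorem not_isFunctionOfGenerated_invJ (h : IsCounterexample A p q E) {V : Set (ℝ × ℝ)}
    (hV : IsOpen V) (hne : V.Nonempty) (hVE : V ⊆ E.dom) :
    ¬ IsFunctionOfGenerated (jmwSet ∪ ibragimovSet₁) invariantOps invJ E V := by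
  refine not_isFunctionOfGenerated ?_ ?_ hV hne fun z hz =>
    h.H_isProfile.Dx_jExpr_ne_zero (fun _ => h.P_eq) (hVE hz) h.deriv_p_ne
  · have hP : IndependentOfX (invP.val E) (invP.dom E) :=
      independentOfX_of_eq p fun z hz => h.P_eq hz.1
    have hQ : IndependentOfX (invQ.val E) (invQ.dom E) :=
      independentOfX_of_eq q fun z hz => h.Q_eq hz.1
    rintro G ((rfl | rfl | rfl | rfl | rfl) | (rfl | rfl | rfl | rfl))
    · exact hP
    · exact hQ
    · exact independentOfX_of_eq (fun t => 2 * p t * q t) fun z hz => h.invJ13_eq hz.1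
    · exact independentOfX_of_eq (fun _ => 0) fun z hz => h.invJ23_eq hz.1
    · exact independentOfX_of_eq (fun _ => 0) fun z hz => h.invJ33_eq hz.1
    · exact hP
    · exact hQ
    · exact independentOfX_of_eq (fun _ => 0) fun z hz => h.invI_eq hz.1
    · exact independentOfX_of_eq (fun t => q t / p t) fun z hz => h.invQtilde_eq hz.1
  · have hzero : IndependentOfX (zeroFn.val E) (zeroFn.dom E) := fun _ _ _ _ _ => rfl
    rintro D (rfl | rfl | rfl | rfl | rfl | rfl | rfl | rfl)
    · exact independentOfX_of_eq (fun t => (deriv p t)⁻¹) fun z hz =>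
        congrArg (·⁻¹) (h.Dt_P_eq hz.1)
    · exact hzero
    · exact hzero
    · exact independentOfX_of_eq (fun _ => 0) fun z hz => by
        simp [overHDt, h.Dx_P_eq hz.1]
    · exact independentOfX_of_eq (fun t => (deriv q t)⁻¹) fun z hz =>
        congrArg (·⁻¹) (h.Dt_Q_eq hz.1)
    · exact hzero
    · exact hzero
    · exact independentOfX_of_eq (fun _ => 0) fun z hz => by
        simp [overHDt, h.Dx_Q_eq hz.1]

end IsCounterexample

/-- The open set on which the concrete equations below live. -/
def exampleDom : Set (ℝ × ℝ) := {z | 0 < z.1 ∧ z.1 + z.2 ≠ 0}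

lemma isOpen_exampleDom : IsOpen exampleDom :=
  (isOpen_lt continuous_const continuous_fst).inter
    (isOpen_ne.preimage (continuous_fst.add continuous_snd))

lemma exampleDom_nonempty : exampleDom.Nonempty := ⟨(1, 0), by norm_num [exampleDom]⟩

/-- The equation of the counterexample with `p(t) = q(t) = t`. -/
noncomputable def exampleEquation : Equation where
  dom := exampleDom
  isOpen_dom := isOpen_exampleDom
  T _ := 1
  X z := 2 * (z.1 - 1) / (z.1 * (z.1 + z.2))
  U z := 2 * (1 - (z.1 - 1) * (z.1 + z.2)) / (z.1 * (z.1 + z.2) ^ 2)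
  smooth_T := contDiffOn_const
  smooth_X := ContDiffOn.div (by fun_prop) (by fun_prop)
    fun _ hz => mul_ne_zero hz.1.ne' hz.2
  smooth_U := ContDiffOn.div (by fun_prop) (by fun_prop)
    fun _ hz => mul_ne_zero hz.1.ne' (pow_ne_zero 2 hz.2)

lemma isCounterexample_exampleEquation :
    IsCounterexample (Ioi 0) (fun t => t) (fun t => t) exampleEquation where
  isOpen := isOpen_Ioi
  smooth_p := contDiffOn_id
  smooth_q := contDiffOn_id
  p_ne _ ht := (mem_Ioi.1 ht).ne'
  q_ne _ ht := (mem_Ioi.1 ht).ne'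
  deriv_p_ne _ _ := by simp
  deriv_q_ne _ _ := by simp
  dom _ hz := hz
  T_eq _ _ := rfl
  X_eq _ _ := rfl
  U_eq _ _ := rfl

/-! ### Moutard equations -/

lemma P_eq_one {E : Equation} (hE : E ∈ moutardClass) {z : ℝ × ℝ}
    (hz : z ∈ E.dom) (hU : E.U z ≠ 0) : E.P z = 1 := by
  rw [Equation.P, H_eq_U hE hz, K_eq_U hE hz, div_self hU]

lemma Dt_P_eq_zero {E : Equation} (hE : E ∈ moutardClass) {z : ℝ × ℝ}
    (hz : z ∈ E.dom) (hU : E.U z ≠ 0) : Dt E.P z = 0 :=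
  Dt_eq_of_hasDerivAt (isOpen_U_ne E) (g := fun _ => 1) (fun _ h => P_eq_one hE h.1 h.2)
    ⟨hz, hU⟩ (hasDerivAt_const _ _)

lemma Dx_P_eq_zero {E : Equation} (hE : E ∈ moutardClass) {z : ℝ × ℝ}
    (hz : z ∈ E.dom) (hU : E.U z ≠ 0) : Dx E.P z = 0 :=
  Dx_eq_of_hasDerivAt (isOpen_U_ne E) (g := fun _ => 1) (fun _ h => P_eq_one hE h.1 h.2)
    ⟨hz, hU⟩ (hasDerivAt_const _ _)

lemma invQtilde_eq_invQ {E : Equation} (hE : E ∈ moutardClass) {z : ℝ × ℝ}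
    (hz : z ∈ E.dom) : invQtilde.val E z = invQ.val E z := by
  have h : EqOn (fun w => Real.log |E.K w|) (fun w => Real.log |E.H w|) E.dom := fun w hw => by
    simp only [K_eq_U hE hw, H_eq_U hE hw]
  simp only [invQtilde, invQ, Equation.Q]
  rw [Dx_congr E.isOpen_dom (Dt_congr E.isOpen_dom h) hz, K_eq_U hE hz, H_eq_U hE hz,
    div_eq_mul_inv]

lemma invJ_dom_eq_empty {E : Equation} (hE : E ∈ moutardClass) : invJ.dom E = ∅ :=
  eq_empty_of_forall_notMem fun z ⟨hz, hH, hP⟩ =>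
    hP (Dt_P_eq_zero hE hz (by rwa [← H_eq_U hE hz]))

lemma ibragimovD₁_coefT_dom_eq_empty {E : Equation} (hE : E ∈ moutardClass) :
    ibragimovD₁.coefT.dom E = ∅ :=
  eq_empty_of_forall_notMem fun z ⟨hz, hH, hP⟩ =>
    hP (Dt_P_eq_zero hE hz (by rwa [← H_eq_U hE hz]))

lemma ibragimovD₂_coefX_dom_eq_empty {E : Equation} (hE : E ∈ moutardClass) :
    ibragimovD₂.coefX.dom E = ∅ :=
  eq_empty_of_forall_notMem fun z ⟨hz, hH, hP⟩ =>
    hP (Dx_P_eq_zero hE hz (by rwa [← H_eq_U hE hz]))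

/-- The Moutard equation `u_tx = 2 / (t (t + x)²) u`, for which `(ln |U|)_tx / U = t`. -/
noncomputable def exampleMoutard : Equation where
  dom := exampleDom
  isOpen_dom := isOpen_exampleDom
  T _ := 0
  X _ := 0
  U z := 2 / (z.1 * (z.1 + z.2) ^ 2)
  smooth_T := contDiffOn_const
  smooth_X := contDiffOn_const
  smooth_U := ContDiffOn.div (by fun_prop) (by fun_prop)
    fun _ hz => mul_ne_zero hz.1.ne' (pow_ne_zero 2 hz.2)

lemma exampleMoutard_mem : exampleMoutard ∈ moutardClass := fun _ _ => ⟨rfl, rfl⟩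

lemma exampleMoutard_isProfile :
    IsProfile exampleMoutard.dom (Ioi 0) (fun t => t) exampleMoutard.U where
  isOpen_V := isOpen_exampleDom
  isOpen_A := isOpen_Ioi
  smooth := contDiffOn_id
  ne_zero _ ht := (mem_Ioi.1 ht).ne'
  mem _ hz := hz
  eq _ _ := rfl

lemma exampleMoutard_isProfile_H :
    IsProfile exampleMoutard.dom (Ioi 0) (fun t => t) exampleMoutard.H where
  isOpen_V := isOpen_exampleDom
  isOpen_A := isOpen_Ioi
  smooth := contDiffOn_id
  ne_zero _ ht := (mem_Ioi.1 ht).ne'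
  mem _ hz := hz
  eq _ hz := H_eq_U exampleMoutard_mem hz

lemma moutardQ_exampleMoutard {z : ℝ × ℝ} (hz : z ∈ exampleMoutard.dom) :
    moutardQ exampleMoutard z = z.1 := by
  have h := exampleMoutard_isProfile
  have ht0 : z.1 ≠ 0 := hz.1.ne'
  have hs0 : z.1 + z.2 ≠ 0 := hz.2
  rw [moutardQ, h.Dt_Dx_eq hz, h.Dt_eq hz, h.Dx_eq hz, h.eq z hz]
  field_simp
  ring

lemma exampleMoutard_dom_subset : exampleMoutard.dom ⊆ invMoutard.dom exampleMoutard :=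
  fun z hz => ⟨hz, exampleMoutard_isProfile.apply_ne_zero hz, by
    rw [(exampleMoutard_isProfile.jExpr_eq (p := fun t => t)
      (fun _ => moutardQ_exampleMoutard) hz (by simp)).1]
    simp⟩

theorem not_isFunctionOfGenerated_invMoutard {V : Set (ℝ × ℝ)} (hV : IsOpen V)
    (hne : V.Nonempty) (hVE : V ⊆ exampleMoutard.dom) :
    ¬ IsFunctionOfGenerated (ibragimovSet₁ ∪ ibragimovSet₂) ibragimovOps invMoutard
      exampleMoutard V := by
  have hE := exampleMoutard_mem
  refine not_isFunctionOfGenerated ?_ ?_ hV hne fun z hz =>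
    exampleMoutard_isProfile.Dx_jExpr_ne_zero (p := fun t => t)
      (fun _ => moutardQ_exampleMoutard) (hVE hz) (by simp)
  · have hU {z} (hz : z ∈ exampleMoutard.dom) : exampleMoutard.U z ≠ 0 :=
      exampleMoutard_isProfile.apply_ne_zero hz
    have hP : IndependentOfX (invP.val exampleMoutard) (invP.dom exampleMoutard) :=
      independentOfX_of_eq (fun _ => 1) fun z hz => P_eq_one hE hz.1 (hU hz.1)
    have hQ : IndependentOfX (invQ.val exampleMoutard) (invQ.dom exampleMoutard) :=
      independentOfX_of_eq (fun t => t) fun z hz => exampleMoutard_isProfile_H.log_eq hz.1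
    have hI : IndependentOfX (invI.val exampleMoutard) (invI.dom exampleMoutard) :=
      independentOfX_of_eq (fun _ => 0) fun z hz => by
        simp [invI, Dx_P_eq_zero hE hz.1 (hU hz.1)]
    rintro G ((rfl | rfl | rfl | rfl) | (rfl | rfl | rfl | rfl))
    · exact hP
    · exact hQ
    · exact hI
    · exact independentOfX_of_eq (fun t => t) fun z hz =>
        (invQtilde_eq_invQ hE hz.1).trans (exampleMoutard_isProfile_H.log_eq hz.1)
    · exact hP
    · exact hQ
    · exact hI
    · intro t x y hx
      rw [invJ_dom_eq_empty hE] at hx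
      exact hx.elim
  · rintro D (rfl | rfl)
    · intro t x y hx
      rw [ibragimovD₁_coefT_dom_eq_empty hE] at hx
      exact hx.elim
    · exact fun _ _ _ _ _ => rfl

end LinHyp

open LinHyp in
theorem mainTheorem3 :
    -- the invariants of the explicit equation
    (∀ (A : Set ℝ) (p q : ℝ → ℝ) (E : Equation), IsCounterexample A p q E →
      (∀ z ∈ E.dom,
        (z ∈ invP.dom E ∧ invP.val E z = p z.1) ∧
        (z ∈ invQ.dom E ∧ invQ.val E z = q z.1) ∧
        (z ∈ invJ13.dom E ∧ invJ13.val E z = 2 * p z.1 * q z.1) ∧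
        (z ∈ invJ23.dom E ∧ invJ23.val E z = 0) ∧
        (z ∈ invJ33.dom E ∧ invJ33.val E z = 0) ∧
        (z ∈ invI.dom E ∧ invI.val E z = 0) ∧
        (z ∈ invQtilde.dom E ∧ invQtilde.val E z = q z.1 / p z.1) ∧
        (z ∈ invJ.dom E ∧ invJ.val E z =
          -2 / (deriv p z.1 * (z.1 + z.2)) - deriv (deriv p) z.1 / deriv p z.1 ^ 2
            - deriv q z.1 / (deriv p z.1 * q z.1)) ∧
        Dx (invJ.val E) z ≠ 0) ∧
      -- on no open set is `J` a function of the other invariants and their invariant derivatives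
      (∀ V : Set (ℝ × ℝ), IsOpen V → V.Nonempty → V ⊆ E.dom →
        ¬ IsFunctionOfGenerated (jmwSet ∪ ibragimovSet₁) invariantOps invJ E V)) ∧
    -- there are such equations
    (∃ (A : Set ℝ) (p q : ℝ → ℝ) (E : Equation), IsCounterexample A p q E ∧ E.dom.Nonempty) ∧
    -- `J` is a contact invariant, and the two sets are not bases for the whole class
    IsDifferentialInvariant Set.univ invJ ∧
    (∀ 𝒟 ⊆ invariantOps,
      ¬ IsBasis Set.univ jmwSet 𝒟 ∧ ¬ IsBasis Set.univ ibragimovSet₁ 𝒟) ∧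
    -- the invariants of Moutard's equation
    (∀ E ∈ moutardClass,
      (∀ z ∈ E.dom, E.U z ≠ 0 →
        (z ∈ invP.dom E ∧ invP.val E z = 1) ∧
        Dt (invP.val E) z = 0 ∧ Dx (invP.val E) z = 0 ∧
        (z ∈ invI.dom E ∧ invI.val E z = 0) ∧
        z ∈ invQ.dom E ∧ z ∈ invQtilde.dom E ∧ invQtilde.val E z = invQ.val E z) ∧
      invJ.dom E = ∅ ∧
      (∀ G : DiffFn, (ibragimovD₁.apply G).dom E = ∅ ∧ (ibragimovD₂.apply G).dom E = ∅)) ∧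
    -- neither of Ibragimov's sets is a basis for the Moutard subclass
    (∃ F : DiffFn, IsDifferentialInvariant moutardClass F ∧
      ∃ E ∈ moutardClass, E.dom.Nonempty ∧ E.dom ⊆ F.dom E ∧
        ∀ V : Set (ℝ × ℝ), IsOpen V → V.Nonempty → V ⊆ E.dom →
          ¬ IsFunctionOfGenerated (ibragimovSet₁ ∪ ibragimovSet₂) ibragimovOps F E V) ∧
    ¬ IsBasis moutardClass ibragimovSet₁ ibragimovOps ∧
    ¬ IsBasis moutardClass ibragimovSet₂ ibragimovOps := by
  have hJ {A : Set ℝ} {p q : ℝ → ℝ} {E : Equation} (h : IsCounterexample A p q E) {z : ℝ × ℝ}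
      (hz : z ∈ E.dom) : z ∈ invJ.dom E :=
    ⟨hz, h.H_isProfile.apply_ne_zero hz, by
      rw [h.Dt_P_eq hz]
      exact h.deriv_p_ne _ (h.dom z hz).1⟩
  have huniv {S : Set DiffFn} (hS : S ⊆ jmwSet ∪ ibragimovSet₁) {𝒟 : Set DiffOp}
      (h𝒟 : 𝒟 ⊆ invariantOps) : ¬ IsBasis Set.univ S 𝒟 := fun hB => by
    have hex := isCounterexample_exampleEquation
    obtain ⟨V, hV, hne, hVE, hgen⟩ := hB.exists_isFunctionOfGenerated
      isDifferentialInvariant_invJ (Set.mem_univ exampleEquation) (fun z hz => hJ hex hz)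
      exampleDom_nonempty
    exact hex.not_isFunctionOfGenerated_invJ hV hne hVE (hgen.mono hS h𝒟)
  have hmoutard {S : Set DiffFn} (hS : S ⊆ ibragimovSet₁ ∪ ibragimovSet₂) :
      ¬ IsBasis moutardClass S ibragimovOps := fun hB => by
    obtain ⟨V, hV, hne, hVE, hgen⟩ := hB.exists_isFunctionOfGenerated
      isDifferentialInvariant_invMoutard exampleMoutard_mem exampleMoutard_dom_subset
      exampleDom_nonempty
    exact not_isFunctionOfGenerated_invMoutard hV hne hVE (hgen.mono hS subset_rfl)
  refine ⟨fun A p q E h => ⟨fun z hz => ?_, fun V hV hne hVE =>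
      h.not_isFunctionOfGenerated_invJ hV hne hVE⟩,
    ⟨_, _, _, _, isCounterexample_exampleEquation, exampleDom_nonempty⟩,
    isDifferentialInvariant_invJ,
    fun 𝒟 h𝒟 => ⟨huniv Set.subset_union_left h𝒟, huniv Set.subset_union_right h𝒟⟩,
    fun E hE => ⟨fun z hz hU => ?_, invJ_dom_eq_empty hE, fun G => ⟨?_, ?_⟩⟩,
    ⟨invMoutard, isDifferentialInvariant_invMoutard, exampleMoutard, exampleMoutard_mem,
      exampleDom_nonempty, exampleMoutard_dom_subset, fun V hV hne hVE =>
        not_isFunctionOfGenerated_invMoutard hV hne hVE⟩,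
    hmoutard Set.subset_union_left, hmoutard Set.subset_union_right⟩
  · have hH : z ∈ E.dom ∧ E.H z ≠ 0 := ⟨hz, h.H_isProfile.apply_ne_zero hz⟩
    exact ⟨⟨hH, h.P_eq hz⟩, ⟨hH, h.Q_eq hz⟩, ⟨hH, h.invJ13_eq hz⟩, ⟨hH, h.invJ23_eq hz⟩,
      ⟨hH, h.invJ33_eq hz⟩, ⟨hH, h.invI_eq hz⟩,
      ⟨⟨hz, h.K_isProfile.apply_ne_zero hz⟩, h.invQtilde_eq hz⟩,
      ⟨hJ h hz, (h.H_isProfile.jExpr_eq (fun _ => h.P_eq) hz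
        (h.deriv_p_ne _ (h.dom z hz).1)).2⟩,
      h.H_isProfile.Dx_jExpr_ne_zero (fun _ => h.P_eq) hz h.deriv_p_ne⟩
  · have hH : z ∈ E.dom ∧ E.H z ≠ 0 := ⟨hz, by rwa [H_eq_U hE hz]⟩
    exact ⟨⟨hH, P_eq_one hE hz hU⟩, Dt_P_eq_zero hE hz hU, Dx_P_eq_zero hE hz hU,
      ⟨hH, by simp [invI, Dx_P_eq_zero hE hz hU]⟩, hH, ⟨hz, by rwa [K_eq_U hE hz]⟩,
      invQtilde_eq_invQ hE hz⟩
  · simp [DiffOp.apply, ibragimovD₁_coefT_dom_eq_empty hE]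
  · simp [DiffOp.apply, ibragimovD₂_coefX_dom_eq_empty hE]
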